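/- Let $F$ be a germ of a holomorphic diffeomorphism of $\mathbb{C}^2$ fixing the origin, i.e. $F\in\mathrm{Diff}(\mathbb{C}^2,0)$. An (irreducible) formal curve is a principal ideal $\Gamma$ of $\mathbb{C}[[x,y]]$ generated by an irreducible series; it is $F$-invariant if $h\circ F\in\Gamma$ for every $h\in\Gamma$. A parametrization of $\Gamma$ is a pair $\gamma(s)\in\mathbb{C}[[s]]^2\setminus\{0\}$ with $\gamma(0)=(0,0)$ such that $h\in\Gamma$ if and only if $h(\gamma(s))=0$; it is irreducible if it is not of the form $\sigma(\tau(s))$ with $\sigma$ a parametrization of $\Gamma$ and $\tau\in\mathbb{C}[[s]]$, $\tau(0)=\tau'(0)=0$. If $\Gamma$ is $F$-invariant and $\gamma$ is an irreducible parametrization of $\Gamma$, there is $\theta\in\mathbb{C}[[s]]$ with $\theta(0)=0$, $\theta'(0)\neq0$ and $F\circ\gamma=\gamma\circ\theta$, and the inner eigenvalue $\lambda_\Gamma=\theta'(0)$ does not depend on the choice of $\gamma$. The invariant curve $\Gamma$ is called hyperbolic if $|\lambda_\Gamma|\neq1$. Theorem. Every hyperbolic invariant formal curve $\Gamma$ of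 $F\in\mathrm{Diff}(\mathbb{C}^2,0)$ is an analytic curve, i.e. the ideal $\Gamma$ is generated by a convergent power series. -/

import Mathlib

namespace HypCurve

/-- The formal Taylor series at the origin of a function `f` of two complex variables: the
coefficient of `x ^ i * y ^ j` is `(1 / (i! j!)) * ∂ₓ^i ∂ᵧ^j f (0, 0)`. -/
noncomputable def taylorSeries (f : (Fin 2 → ℂ) → ℂ) : MvPowerSeries (Fin 2) ℂ :=
  fun d : Fin 2 →₀ ℕ =>
    iteratedDeriv (d 0) (fun x : ℂ => iteratedDeriv (d 1) (fun y : ℂ => f ![x, y]) 0) 0 /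
      ((Nat.factorial (d 0) : ℂ) * (Nat.factorial (d 1) : ℂ))

/-- `F` represents a germ of holomorphic diffeomorphism of `ℂ²` fixing the origin. -/
structure IsDiffGerm (F : (Fin 2 → ℂ) → (Fin 2 → ℂ)) : Prop where
  analyticAt : AnalyticAt ℂ F 0
  map_zero : F 0 = 0
  bijective_fderiv : Function.Bijective (fderiv ℂ F 0)

/-- The pair of Taylor series at the origin of the two components of `F`. -/
noncomputable def formalMap (F : (Fin 2 → ℂ) → (Fin 2 → ℂ)) :
    Fin 2 → MvPowerSeries (Fin 2) ℂ :=
  fun i => taylorSeries (fun z => F z i)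

/-- An (irreducible) formal curve at the origin of `ℂ²`: a principal ideal of `ℂ⟦x, y⟧` generated
by an irreducible series. -/
def IsFormalCurve (Γ : Ideal (MvPowerSeries (Fin 2) ℂ)) : Prop :=
  ∃ f : MvPowerSeries (Fin 2) ℂ, Irreducible f ∧ Γ = Ideal.span {f}

/-- `Γ` is invariant by `F`: `h ∘ F ∈ Γ` for every `h ∈ Γ`. -/
def IsInvariant (F : (Fin 2 → ℂ) → (Fin 2 → ℂ)) (Γ : Ideal (MvPowerSeries (Fin 2) ℂ)) : Prop :=
  ∀ h ∈ Γ, MvPowerSeries.subst (formalMap F) h ∈ Γ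

/-- `γ` is a parametrization of `Γ`: a nonzero pair of series in `ℂ⟦s⟧` without constant term
such that `h ∈ Γ` if and only if `h (γ s) = 0`. -/
structure IsParametrization (Γ : Ideal (MvPowerSeries (Fin 2) ℂ)) (γ : Fin 2 → PowerSeries ℂ) :
    Prop where
  ne_zero : γ ≠ 0
  constantCoeff_eq_zero : ∀ i, PowerSeries.constantCoeff (γ i) = 0
  mem_iff : ∀ h : MvPowerSeries (Fin 2) ℂ,
    h ∈ Γ ↔ (MvPowerSeries.subst γ h : PowerSeries ℂ) = 0

/-- `γ` is an irreducible (primitive) parametrization of `Γ`: it does not factor as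
`γ = σ ∘ τ` through another parametrization `σ` of `Γ` and a series `τ` of order at least two. -/
def IsIrreducibleParametrization (Γ : Ideal (MvPowerSeries (Fin 2) ℂ))
    (γ : Fin 2 → PowerSeries ℂ) : Prop :=
  IsParametrization Γ γ ∧
    ∀ (σ : Fin 2 → PowerSeries ℂ) (τ : PowerSeries ℂ), IsParametrization Γ σ →
      PowerSeries.constantCoeff τ = 0 →
      (∀ i, γ i = (PowerSeries.subst τ (σ i) : PowerSeries ℂ)) →
      PowerSeries.coeff 1 τ ≠ 0

/-- `θ` is a restriction of `F` to `Γ`: a formal diffeomorphism in one variable with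
`F ∘ γ = γ ∘ θ` for an irreducible parametrization `γ` of `Γ`. -/
def IsRestriction (F : (Fin 2 → ℂ) → (Fin 2 → ℂ)) (Γ : Ideal (MvPowerSeries (Fin 2) ℂ))
    (θ : PowerSeries ℂ) : Prop :=
  PowerSeries.constantCoeff θ = 0 ∧ PowerSeries.coeff 1 θ ≠ 0 ∧
    ∃ γ : Fin 2 → PowerSeries ℂ, IsIrreducibleParametrization Γ γ ∧
      ∀ i, (MvPowerSeries.subst γ (formalMap F i) : PowerSeries ℂ) =
        (PowerSeries.subst θ (γ i) : PowerSeries ℂ)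

/-- `lam` is the inner eigenvalue of `F` along `Γ`, i.e. `lam = θ'(0)` for `θ = F|_Γ`. -/
def IsInnerEigenvalue (F : (Fin 2 → ℂ) → (Fin 2 → ℂ)) (Γ : Ideal (MvPowerSeries (Fin 2) ℂ))
    (lam : ℂ) : Prop :=
  ∃ θ : PowerSeries ℂ, IsRestriction F Γ θ ∧ PowerSeries.coeff 1 θ = lam

/-- `Γ` is hyperbolic for `F`: its inner eigenvalue does not have modulus one. -/
def IsHyperbolic (F : (Fin 2 → ℂ) → (Fin 2 → ℂ)) (Γ : Ideal (MvPowerSeries (Fin 2) ℂ)) : Prop :=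
  ∃ lam : ℂ, IsInnerEigenvalue F Γ lam ∧ ‖lam‖ ≠ 1

/-- `f` is a convergent power series: it converges absolutely on some polydisc. -/
def IsConvergent (f : MvPowerSeries (Fin 2) ℂ) : Prop :=
  ∃ r : ℝ, 0 < r ∧ Summable fun d : Fin 2 →₀ ℕ => ‖MvPowerSeries.coeff d f‖ * r ^ (d 0 + d 1)

/-- The formal curve `Γ` is an analytic curve: it has a convergent generator. -/
def IsAnalyticCurve (Γ : Ideal (MvPowerSeries (Fin 2) ℂ)) : Prop :=
  ∃ f : MvPowerSeries (Fin 2) ℂ, IsConvergent f ∧ Γ = Ideal.span {f}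

end HypCurve

/-! Let `γ` parametrize the curve, with F ∘ γ = γ ∘ θ, θ'(0) = λ and |λ| ≠ 1. As λ is neither zero
nor a root of unity, θ is formally conjugate to s ↦ λs (`exists_formal_linearization`), so after a
formal change of parameter F(γ(s)) = γ(λs). With L = DF(0), comparing coefficients of sⁿ expresses
(λⁿ − L)γₙ through the nonlinear part of F and the earlier coefficients of `γ`. Since L is
invertible and |λ| ≠ 1, λⁿ − L has a uniformly bounded inverse for large n
(`exists_le_norm_pow_smul_sub`). There are thus no small divisors, and a majorant estimate makes `γ`
converge (`isConvergentSeries_of_semiconj`). The finitely many remaining n are harmless because `γ`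
is already given as a formal series.

It remains to pass from a convergent parametrization to a convergent equation
(`isAnalyticCurve_of_convergent`). Unless the curve is y = 0, Weierstrass preparation gives a
generator W that is a monic polynomial in x over ℂ[[y]]. Write γ₁ = sⁿu with u(0) ≠ 0. Then ℂ[[s]]
is free over ℂ[[γ₁]] on 1, …, sⁿ⁻¹, and `expansion` reads off coordinates, preserving convergence.
Hence W(γ) = 0 is a linear system for the coefficients of W whose data are convergent. Uniqueness of
Weierstrass division makes its solution unique, and a unique solution lies in the subring of the
data when that subring is closed under exact division (`mem_of_sum_mul_mem`). -/

namespace HypCurve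

/-! ### Majorant norms and the ring of convergent series in one variable. -/

open PowerSeries Finset

/-- The partial sum of order `N` of the majorant norm `∑ ‖aₙ‖ r ^ n` of a power series. -/
noncomputable def partialNorm (r : ℝ) (N : ℕ) (a : PowerSeries ℂ) : ℝ :=
  ∑ n ∈ range N, ‖coeff n a‖ * r ^ n

theorem partialNorm_nonneg {r : ℝ} (hr : 0 ≤ r) (N : ℕ) (a : PowerSeries ℂ) :
    0 ≤ partialNorm r N a :=
  sum_nonneg fun _ _ => by positivity

theorem partialNorm_mono_radius {r r' : ℝ} (hr : 0 ≤ r') (h : r' ≤ r) (N : ℕ)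
    (a : PowerSeries ℂ) : partialNorm r' N a ≤ partialNorm r N a :=
  sum_le_sum fun _ _ => by gcongr

theorem partialNorm_add_le {r : ℝ} (hr : 0 ≤ r) (N : ℕ) (a b : PowerSeries ℂ) :
    partialNorm r N (a + b) ≤ partialNorm r N a + partialNorm r N b := by
  simp only [partialNorm, ← sum_add_distrib, ← add_mul]
  refine sum_le_sum fun n _ => ?_
  rw [map_add]
  gcongr
  exact norm_add_le _ _

theorem norm_coeff_mul_pow_le {r : ℝ} (hr : 0 ≤ r) {n N : ℕ} (h : n < N) (a : PowerSeries ℂ) :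
    ‖coeff n a‖ * r ^ n ≤ partialNorm r N a :=
  single_le_sum (f := fun n => ‖coeff n a‖ * r ^ n) (fun _ _ => by positivity) (mem_range.2 h)

/-- The constraint on total degree is kept: it is what lets a factor without constant term lower the
truncation order of the other factor. -/
theorem partialNorm_mul_le_sum {r : ℝ} (hr : 0 ≤ r) (N : ℕ) (a b : PowerSeries ℂ) :
    partialNorm r N (a * b) ≤ ∑ p ∈ (range N ×ˢ range N) with p.1 + p.2 < N,
      (‖coeff p.1 a‖ * r ^ p.1) * (‖coeff p.2 b‖ * r ^ p.2) := by
  have h1 : partialNorm r N (a * b) ≤ ∑ n ∈ range N, ∑ p ∈ antidiagonal n,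
      (‖coeff p.1 a‖ * r ^ p.1) * (‖coeff p.2 b‖ * r ^ p.2) := by
    refine sum_le_sum fun n _ => ?_
    rw [coeff_mul]
    calc _ ≤ (∑ p ∈ antidiagonal n, ‖coeff p.1 a * coeff p.2 b‖) * r ^ n := by
          gcongr; exact norm_sum_le _ _
      _ = _ := by
          rw [sum_mul]
          refine sum_congr rfl fun p hp => ?_
          rw [← mem_antidiagonal.1 hp, norm_mul, pow_add]; ring
  refine h1.trans (le_of_eq ?_)
  rw [sum_sigma']
  refine sum_bij' (fun x _ => x.2) (fun p _ => ⟨p.1 + p.2, p⟩) ?_ ?_ ?_ ?_ ?_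
  · rintro ⟨n, i, j⟩ h
    simp only [mem_sigma, mem_range, HasAntidiagonal.mem_antidiagonal, mem_filter, mem_product] at h ⊢
    omega
  · rintro ⟨i, j⟩ h
    simp only [mem_sigma, mem_range, HasAntidiagonal.mem_antidiagonal, mem_filter, mem_product] at h ⊢
    exact ⟨h.2, trivial⟩
  · rintro ⟨n, i, j⟩ h
    simp only [mem_sigma, mem_range, HasAntidiagonal.mem_antidiagonal] at h
    obtain ⟨_, rfl⟩ := h
    rfl
  · rintro ⟨i, j⟩ h; rfl
  · rintro ⟨n, i, j⟩ h; rfl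

theorem partialNorm_mul_le {r : ℝ} (hr : 0 ≤ r) (N : ℕ) (a b : PowerSeries ℂ) :
    partialNorm r N (a * b) ≤ partialNorm r N a * partialNorm r N b := by
  refine (partialNorm_mul_le_sum hr N a b).trans ?_
  rw [partialNorm, partialNorm, sum_mul_sum, ← sum_product']
  exact sum_le_sum_of_subset_of_nonneg (filter_subset _ _) fun _ _ _ => by positivity

theorem partialNorm_succ_mul_le_of_left {r : ℝ} (hr : 0 ≤ r) (N : ℕ) {a : PowerSeries ℂ}
    (ha : constantCoeff a = 0) (b : PowerSeries ℂ) :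
    partialNorm r (N + 1) (a * b) ≤ partialNorm r (N + 1) a * partialNorm r N b := by
  refine (partialNorm_mul_le_sum hr _ a b).trans ?_
  rw [partialNorm, partialNorm, sum_mul_sum, ← sum_product']
  rw [← sum_filter_add_sum_filter_not _ (fun p : ℕ × ℕ => p.1 = 0)]
  rw [sum_eq_zero, zero_add]
  · refine sum_le_sum_of_subset_of_nonneg ?_ fun _ _ _ => by positivity
    rintro ⟨i, j⟩ h
    simp only [mem_range, mem_filter, mem_product] at h ⊢
    omega
  · rintro ⟨i, j⟩ h
    simp only [mem_filter] at h
    simp [h.2, ha]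

/-- Both indices are at least 1 and sum to at most N, so each is below N. This gain of one order
drives the majorant induction for the parametrization. -/
theorem partialNorm_succ_mul_le {r : ℝ} (hr : 0 ≤ r) (N : ℕ) {a b : PowerSeries ℂ}
    (ha : constantCoeff a = 0) (hb : constantCoeff b = 0) :
    partialNorm r (N + 1) (a * b) ≤ partialNorm r N a * partialNorm r N b := by
  refine (partialNorm_mul_le_sum hr _ a b).trans ?_
  rw [partialNorm, partialNorm, sum_mul_sum, ← sum_product']
  rw [← sum_filter_add_sum_filter_not _ (fun p : ℕ × ℕ => p.1 = 0 ∨ p.2 = 0)]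
  rw [sum_eq_zero, zero_add]
  · refine sum_le_sum_of_subset_of_nonneg ?_ fun _ _ _ => by positivity
    rintro ⟨i, j⟩ h
    simp only [mem_range, mem_filter, mem_product] at h ⊢
    omega
  · rintro ⟨i, j⟩ h
    simp only [mem_filter] at h
    rcases h.2 with h | h <;> simp [h, ha, hb]

theorem partialNorm_one_le {r : ℝ} (N : ℕ) : partialNorm r N 1 ≤ 1 := by
  cases N with
  | zero => simp [partialNorm]
  | succ N => simp [partialNorm, sum_range_succ', coeff_one]

theorem partialNorm_pow_le {r : ℝ} (hr : 0 ≤ r) (N : ℕ) (a : PowerSeries ℂ) (k : ℕ) :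
    partialNorm r N (a ^ k) ≤ partialNorm r N a ^ k := by
  induction k with
  | zero => simpa using partialNorm_one_le N
  | succ k ih =>
    rw [pow_succ, pow_succ]
    exact (partialNorm_mul_le hr _ _ _).trans
      (mul_le_mul_of_nonneg_right ih (partialNorm_nonneg hr _ _))

theorem partialNorm_le_of_constantCoeff_eq_zero {r r' : ℝ} (hr : 0 < r) (hr' : 0 ≤ r')
    (h : r' ≤ r) (N : ℕ) {a : PowerSeries ℂ} (ha : constantCoeff a = 0) :
    partialNorm r' N a ≤ r' / r * partialNorm r N a := by
  rw [partialNorm, partialNorm, mul_sum]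
  refine sum_le_sum fun n _ => ?_
  rcases n with _ | n
  · simp [ha]
  · have : r' ^ (n + 1) ≤ r' / r * r ^ (n + 1) := by
      have h2 : r' / r * r ^ (n + 1) = r' * r ^ n := by field_simp; ring
      rw [h2, pow_succ']
      gcongr
    calc _ ≤ ‖coeff (n + 1) a‖ * (r' / r * r ^ (n + 1)) := by gcongr
      _ = _ := by ring

theorem partialNorm_X_pow_mul {r : ℝ} (k N : ℕ) (a : PowerSeries ℂ) :
    partialNorm r (N + k) (X ^ k * a) = r ^ k * partialNorm r N a := by
  rw [partialNorm, add_comm N k, sum_range_add, sum_eq_zero, zero_add, partialNorm, mul_sum]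
  · refine sum_congr rfl fun n _ => ?_
    rw [add_comm k n, coeff_X_pow_mul, pow_add]; ring
  · intro n hn
    rw [coeff_X_pow_mul', if_neg (by simpa using hn)]; simp

/-- A power series in one variable is convergent if its majorant norm is finite for some positive
radius. -/
def IsConvergentSeries (a : PowerSeries ℂ) : Prop :=
  ∃ r : ℝ, 0 < r ∧ ∃ C : ℝ, ∀ N, partialNorm r N a ≤ C

theorem IsConvergentSeries.exists_common {a b : PowerSeries ℂ} (ha : IsConvergentSeries a)
    (hb : IsConvergentSeries b) : ∃ r : ℝ, 0 < r ∧ ∃ C : ℝ, 0 ≤ C ∧ ∃ D : ℝ, 0 ≤ D ∧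
      (∀ N, partialNorm r N a ≤ C) ∧ ∀ N, partialNorm r N b ≤ D := by
  obtain ⟨r, hr, C, hC⟩ := ha
  obtain ⟨r', hr', D, hD⟩ := hb
  have h0 : 0 < min r r' := lt_min hr hr'
  refine ⟨min r r', h0, C, ?_, D, ?_, fun N => ?_, fun N => ?_⟩
  · simpa [partialNorm] using hC 0
  · simpa [partialNorm] using hD 0
  · exact (partialNorm_mono_radius h0.le (min_le_left _ _) N a).trans (hC N)
  · exact (partialNorm_mono_radius h0.le (min_le_right _ _) N b).trans (hD N)

theorem isConvergentSeries_of_norm_coeff_le {a : PowerSeries ℂ} {M A : ℝ}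
    (h : ∀ n, ‖coeff n a‖ ≤ M * A ^ n) : IsConvergentSeries a := by
  have hM : 0 ≤ M := by simpa using (norm_nonneg _).trans (h 0)
  set B := |A| + 1
  have hB : 0 < B := by positivity
  refine ⟨(2 * B)⁻¹, by positivity, M * 2, fun N => ?_⟩
  calc partialNorm (2 * B)⁻¹ N a ≤ ∑ n ∈ range N, M * (1 / 2) ^ n := by
        refine sum_le_sum fun n _ => ?_
        have h1 : ‖coeff n a‖ ≤ M * B ^ n := (h n).trans (by
          refine mul_le_mul_of_nonneg_left ?_ hM
          calc A ^ n ≤ |A| ^ n := by rw [← abs_pow]; exact le_abs_self _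
            _ ≤ _ := by gcongr; simp [B])
        calc _ ≤ M * B ^ n * (2 * B)⁻¹ ^ n := by gcongr
          _ = _ := by rw [mul_assoc, ← mul_pow]; congr 2; field_simp
    _ ≤ M * 2 := by
        rw [← mul_sum]
        gcongr
        rw [geom_sum_eq (by norm_num)]
        have : (0 : ℝ) < (1 / 2) ^ N := by positivity
        rw [div_le_iff_of_neg (by norm_num)]
        linarith

theorem IsConvergentSeries.exists_norm_coeff_le {a : PowerSeries ℂ} (h : IsConvergentSeries a) :
    ∃ M A : ℝ, 0 ≤ M ∧ 0 < A ∧ ∀ n, ‖coeff n a‖ ≤ M * A ^ n := by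
  obtain ⟨r, hr, C, hC⟩ := h
  refine ⟨C, r⁻¹, by simpa [partialNorm] using hC 0, by positivity, fun n => ?_⟩
  have := (norm_coeff_mul_pow_le hr.le n.lt_succ_self a).trans (hC _)
  rwa [inv_pow, ← div_eq_mul_inv, le_div_iff₀ (by positivity)]

theorem isConvergentSeries_C (c : ℂ) : IsConvergentSeries (C c) := by
  refine isConvergentSeries_of_norm_coeff_le (M := ‖c‖) (A := 1) fun n => ?_
  rw [coeff_C]
  split_ifs <;> simp

theorem IsConvergentSeries.add {a b : PowerSeries ℂ} (ha : IsConvergentSeries a)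
    (hb : IsConvergentSeries b) : IsConvergentSeries (a + b) := by
  obtain ⟨r, hr, C, _, D, _, hC, hD⟩ := ha.exists_common hb
  exact ⟨r, hr, C + D, fun N => (partialNorm_add_le hr.le N a b).trans (add_le_add (hC N) (hD N))⟩

theorem IsConvergentSeries.mul {a b : PowerSeries ℂ} (ha : IsConvergentSeries a)
    (hb : IsConvergentSeries b) : IsConvergentSeries (a * b) := by
  obtain ⟨r, hr, C, hC0, D, _, hC, hD⟩ := ha.exists_common hb
  exact ⟨r, hr, C * D, fun N => (partialNorm_mul_le hr.le N a b).trans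
    (mul_le_mul (hC N) (hD N) (partialNorm_nonneg hr.le _ _) hC0)⟩

/-- The ring of convergent power series in one variable. -/
def convergentSubring : Subring (PowerSeries ℂ) where
  carrier := {a | IsConvergentSeries a}
  mul_mem' := IsConvergentSeries.mul
  add_mem' := IsConvergentSeries.add
  one_mem' := by simpa using isConvergentSeries_C 1
  zero_mem' := by simpa using isConvergentSeries_C 0
  neg_mem' {a} ha := by
    have := (isConvergentSeries_C (-1)).mul ha
    simpa using this

theorem IsConvergentSeries.of_X_pow_mul {k : ℕ} {a : PowerSeries ℂ}
    (h : IsConvergentSeries (X ^ k * a)) : IsConvergentSeries a := by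
  obtain ⟨r, hr, C, hC⟩ := h
  refine ⟨r, hr, C / r ^ k, fun N => ?_⟩
  rw [le_div_iff₀ (by positivity), mul_comm, ← partialNorm_X_pow_mul]
  exact hC _

theorem IsConvergentSeries.inv {u : PowerSeries ℂ} (hu : IsConvergentSeries u) :
    IsConvergentSeries u⁻¹ := by
  by_cases hu0 : constantCoeff u = 0
  · rw [PowerSeries.inv_eq_zero.2 hu0]
    exact convergentSubring.zero_mem
  set c := constantCoeff u
  set w : PowerSeries ℂ := 1 - C c⁻¹ * u with hw
  have hwc : IsConvergentSeries w :=
    convergentSubring.sub_mem convergentSubring.one_mem ((isConvergentSeries_C c⁻¹).mul hu)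
  have hw0 : constantCoeff w = 0 := by simp [hw, c, hu0]
  -- A fixed-point equation: since w has no constant term, coefficients of the right side up to
  -- order N use only those of u⁻¹ below N.
  have hv : u⁻¹ = C c⁻¹ + w * u⁻¹ := by
    rw [hw, sub_mul, mul_assoc, PowerSeries.mul_inv_cancel u hu0]; ring
  obtain ⟨r, hr, D, hD⟩ := hwc
  have hD0 : 0 ≤ D := by simpa [partialNorm] using hD 0
  -- This radius makes w of norm at most 1/2, so the bound 2‖c⁻¹‖ reproduces itself: ‖c⁻¹‖ +
  -- (1/2)(2‖c⁻¹‖).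
  set r' := min r (r / (2 * (D + 1))) with hr'
  have hr'0 : 0 < r' := by positivity
  have hw2 : ∀ N, partialNorm r' N w ≤ 1 / 2 := fun N => by
    calc _ ≤ r' / r * partialNorm r N w :=
          partialNorm_le_of_constantCoeff_eq_zero hr hr'0.le (min_le_left _ _) N hw0
      _ ≤ (r / (2 * (D + 1))) / r * D := by
          refine mul_le_mul ?_ (hD N) (partialNorm_nonneg hr.le _ _) (by positivity)
          exact div_le_div_of_nonneg_right (min_le_right _ _) hr.le
      _ = D / (2 * (D + 1)) := by field_simp
      _ ≤ 1 / 2 := by rw [div_le_div_iff₀ (by positivity) (by norm_num)]; linarith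
  refine ⟨r', hr'0, 2 * ‖c⁻¹‖, fun N => ?_⟩
  induction N with
  | zero => simp [partialNorm]
  | succ N ih =>
    rw [hv]
    refine (partialNorm_add_le hr'0.le _ _ _).trans ?_
    have h1 : partialNorm r' (N + 1) (C c⁻¹) ≤ ‖c⁻¹‖ := by
      simp [partialNorm, sum_range_succ', coeff_C]
    have h2 := partialNorm_succ_mul_le_of_left hr'0.le N hw0 u⁻¹
    have h3 : partialNorm r' (N + 1) w * partialNorm r' N u⁻¹ ≤ 1 / 2 * (2 * ‖c⁻¹‖) :=
      mul_le_mul (hw2 _) ih (partialNorm_nonneg hr'0.le _ _) (by norm_num)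
    linarith

theorem exists_eq_X_pow_mul {a : PowerSeries ℂ} (ha : a ≠ 0) :
    ∃ n u, a = X ^ n * u ∧ constantCoeff u ≠ 0 :=
  ⟨_, _, X_pow_order_mul_divXPowOrder.symm,
    fun h => ha (constantCoeff_divXPowOrder_eq_zero_iff.1 h)⟩

theorem IsConvergentSeries.of_mul_left {a b : PowerSeries ℂ} (ha : IsConvergentSeries a)
    (ha0 : a ≠ 0) (hab : IsConvergentSeries (a * b)) : IsConvergentSeries b := by
  obtain ⟨n, u, rfl, hu⟩ := exists_eq_X_pow_mul ha0
  rw [mul_assoc] at hab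
  have := ha.of_X_pow_mul.inv.mul hab.of_X_pow_mul
  rwa [← mul_assoc, PowerSeries.inv_mul_cancel u hu, one_mul] at this

end HypCurve

/-! ### Expansion of one-variable series in powers of g = sⁿu. -/

namespace HypCurve

open PowerSeries Finset

/-- The series `∑ aₙ₊ₖ sⁿ`. -/
noncomputable def shift (k : ℕ) : PowerSeries ℂ →ₗ[ℂ] PowerSeries ℂ where
  toFun a := PowerSeries.mk fun n => coeff (n + k) a
  map_add' _ _ := by ext; simp
  map_smul' _ _ := by ext; simp

@[simp]
theorem coeff_shift (k n : ℕ) (a : PowerSeries ℂ) : coeff n (shift k a) = coeff (n + k) a := by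
  simp [shift]

theorem shift_X_pow_mul (k : ℕ) (a : PowerSeries ℂ) : shift k (X ^ k * a) = a := by
  ext n; simp [coeff_X_pow_mul]

theorem eq_X_pow_mul_shift {k : ℕ} {a : PowerSeries ℂ} (h : ∀ j < k, coeff j a = 0) :
    a = X ^ k * shift k a := by
  ext n
  rw [coeff_X_pow_mul']
  split_ifs with hn
  · simp [Nat.sub_add_cancel hn]
  · exact h n (not_le.1 hn)

theorem partialNorm_shift_le {r : ℝ} (hr : 0 < r) (k N : ℕ) (a : PowerSeries ℂ) :
    partialNorm r N (shift k a) ≤ (r ^ k)⁻¹ * partialNorm r (N + k) a := by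
  rw [inv_mul_eq_div, le_div_iff₀ (by positivity), partialNorm, partialNorm, add_comm N k,
    sum_range_add, sum_mul]
  refine le_trans (le_of_eq (sum_congr rfl fun n _ => ?_))
    (le_add_of_nonneg_left (sum_nonneg fun _ _ => by positivity))
  rw [coeff_shift, pow_add, add_comm n k]; ring

/-- The quotient of the Weierstrass division of one variable series by `X ^ n * u`. -/
noncomputable def divQuot (n : ℕ) (u : PowerSeries ℂ) : PowerSeries ℂ →ₗ[ℂ] PowerSeries ℂ :=
  LinearMap.mulLeft ℂ u⁻¹ ∘ₗ shift n

theorem divQuot_apply (n : ℕ) (u b : PowerSeries ℂ) : divQuot n u b = u⁻¹ * shift n b := rfl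

theorem divQuot_mul {n : ℕ} {u : PowerSeries ℂ} (hu : constantCoeff u ≠ 0) (b : PowerSeries ℂ) :
    divQuot n u (X ^ n * u * b) = b := by
  rw [divQuot_apply, mul_assoc, shift_X_pow_mul, ← mul_assoc, PowerSeries.inv_mul_cancel u hu,
    one_mul]

theorem eq_mul_divQuot {n : ℕ} {u : PowerSeries ℂ} (hu : constantCoeff u ≠ 0)
    {b : PowerSeries ℂ} (h : ∀ j < n, coeff j b = 0) : b = X ^ n * u * divQuot n u b := by
  rw [divQuot_apply, mul_assoc, ← mul_assoc u, PowerSeries.mul_inv_cancel u hu, one_mul]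
  exact eq_X_pow_mul_shift h

/-- The coefficients `c_j` of the expansion `b = ∑_{j < n} c_j(g) s ^ j`, where `g = X ^ n * u`. -/
noncomputable def expansion (n : ℕ) (u : PowerSeries ℂ) (j : ℕ) :
    PowerSeries ℂ →ₗ[ℂ] PowerSeries ℂ where
  toFun b := PowerSeries.mk fun k => coeff j ((divQuot n u ^ k) b)
  map_add' _ _ := by ext; simp
  map_smul' _ _ := by ext; simp

@[simp]
theorem coeff_expansion (n : ℕ) (u : PowerSeries ℂ) (j k : ℕ) (b : PowerSeries ℂ) :
    coeff k (expansion n u j b) = coeff j ((divQuot n u ^ k) b) := by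
  simp [expansion]

theorem expansion_mul {n : ℕ} {u : PowerSeries ℂ} (hu : constantCoeff u ≠ 0) {j : ℕ} (hj : j < n)
    (b : PowerSeries ℂ) : expansion n u j (X ^ n * u * b) = X * expansion n u j b := by
  ext k
  rcases k with _ | k
  · rw [coeff_expansion, pow_zero, Module.End.one_apply, mul_assoc, coeff_X_pow_mul',
      if_neg (by omega)]
    simp
  · rw [coeff_succ_X_mul, coeff_expansion, coeff_expansion, pow_succ, Module.End.mul_apply,
      divQuot_mul hu]

theorem expansion_pow_mul {n : ℕ} {u : PowerSeries ℂ} (hu : constantCoeff u ≠ 0) {j : ℕ}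
    (hj : j < n) (l : ℕ) (b : PowerSeries ℂ) :
    expansion n u j ((X ^ n * u) ^ l * b) = X ^ l * expansion n u j b := by
  induction l with
  | zero => simp
  | succ l ih => rw [pow_succ', mul_assoc, expansion_mul hu hj, ih, pow_succ', mul_assoc]

theorem hasSubst_X_pow_mul {n : ℕ} (hn : n ≠ 0) (u : PowerSeries ℂ) :
    PowerSeries.HasSubst (X ^ n * u) :=
  .of_constantCoeff_zero' (by simp [hn])

/-- Linearity over ℂ[[g]] holds for polynomials in g. Splitting off a truncation therefore leaves a
defect divisible by X^l for every l, hence zero; this avoids any topology. -/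
theorem expansion_subst_mul {n : ℕ} {u : PowerSeries ℂ} (hu : constantCoeff u ≠ 0) {j : ℕ}
    (hj : j < n) (a b : PowerSeries ℂ) :
    expansion n u j (PowerSeries.subst (X ^ n * u) a * b) = a * expansion n u j b := by
  have hg := hasSubst_X_pow_mul (by omega : n ≠ 0) u
  ext k
  have key : ∀ l, ∀ a : PowerSeries ℂ,
      expansion n u j (PowerSeries.subst (X ^ n * u) a * b) - a * expansion n u j b =
        X ^ l * (expansion n u j (PowerSeries.subst (X ^ n * u) (shift l a) * b) -
          shift l a * expansion n u j b) := by
    intro l a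
    have ha : a = X ^ l * shift l a + ((trunc l a : Polynomial ℂ) : PowerSeries ℂ) := by
      ext m
      simp only [map_add, Polynomial.coeff_coe, coeff_trunc, coeff_X_pow_mul', coeff_shift]
      by_cases h : m < l
      · simp [h, not_le.2 h]
      · simp [h, not_lt.1 h]
    have hp : ∀ p : Polynomial ℂ,
        expansion n u j (PowerSeries.subst (X ^ n * u) (p : PowerSeries ℂ) * b) =
          p * expansion n u j b := by
      intro p
      induction p using Polynomial.induction_on' with
      | add p q hp hq =>
        rw [Polynomial.coe_add, PowerSeries.subst_add hg, add_mul, map_add, hp, hq, add_mul]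
      | monomial i c =>
        have h1 : ((Polynomial.monomial i c : Polynomial ℂ) : PowerSeries ℂ) = c • X ^ i := by
          rw [Polynomial.coe_monomial, monomial_eq_C_mul_X_pow, smul_eq_C_mul]
        rw [h1, PowerSeries.subst_smul hg, PowerSeries.subst_pow hg, PowerSeries.subst_X hg,
          smul_mul_assoc, map_smul, expansion_pow_mul hu hj, smul_mul_assoc]
    conv_lhs => rw [ha]
    rw [PowerSeries.subst_add hg, PowerSeries.subst_mul hg, PowerSeries.subst_pow hg,
      PowerSeries.subst_X hg, add_mul, map_add, hp, mul_assoc, expansion_pow_mul hu hj]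
    ring
  have h := congrArg (coeff k) (key (k + 1) a)
  rw [coeff_X_pow_mul', if_neg (by omega), map_sub, sub_eq_zero] at h
  exact h

/-- When all remainders vanish, every division by g is exact, so b is divisible by all powers of g.
-/
theorem eq_zero_of_expansion_eq_zero {n : ℕ} (hn : n ≠ 0) {u : PowerSeries ℂ}
    (hu : constantCoeff u ≠ 0) {b : PowerSeries ℂ} (h : ∀ j < n, expansion n u j b = 0) :
    b = 0 := by
  have key : ∀ k, b = (X ^ n * u) ^ k * (divQuot n u ^ k) b := by
    intro k
    induction k with
    | zero => simp
    | succ k ih =>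
      have h0 : ∀ j < n, coeff j ((divQuot n u ^ k) b) = 0 := fun j hj => by
        rw [← coeff_expansion, h j hj, map_zero]
      rw [pow_succ' (divQuot n u), Module.End.mul_apply, pow_succ (X ^ n * u), mul_assoc,
        ← eq_mul_divQuot hu h0, ← ih]
  ext m
  rw [key (m + 1), mul_pow, ← pow_mul, mul_assoc, coeff_X_pow_mul', if_neg, map_zero]
  have : 1 ≤ n := by omega
  nlinarith

theorem IsConvergentSeries.expansion {n : ℕ} {u b : PowerSeries ℂ} (hu : IsConvergentSeries u)
    (hb : IsConvergentSeries b) (j : ℕ) : IsConvergentSeries (expansion n u j b) := by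
  obtain ⟨r, hr, U, hU0, B, hB0, hU, hB⟩ := hu.inv.exists_common hb
  -- Each division by g costs a fixed factor at a fixed radius r, so the coefficients of the
  -- expansion grow at most geometrically.
  have key : ∀ k N, partialNorm r N ((divQuot n u ^ k) b) ≤ (U * (r ^ n)⁻¹) ^ k * B := by
    intro k
    induction k with
    | zero => simpa using hB
    | succ k ih =>
      intro N
      rw [pow_succ', Module.End.mul_apply, divQuot_apply]
      calc _ ≤ partialNorm r N u⁻¹ * partialNorm r N (shift n ((divQuot n u ^ k) b)) :=
            partialNorm_mul_le hr.le _ _ _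
        _ ≤ U * ((r ^ n)⁻¹ * ((U * (r ^ n)⁻¹) ^ k * B)) := by
            refine mul_le_mul (hU N) ?_ (partialNorm_nonneg hr.le _ _) hU0
            refine (partialNorm_shift_le hr n N _).trans ?_
            exact mul_le_mul_of_nonneg_left (ih _) (by positivity)
        _ = _ := by ring
  refine isConvergentSeries_of_norm_coeff_le (M := B * (r ^ j)⁻¹) (A := U * (r ^ n)⁻¹) fun k => ?_
  rw [coeff_expansion]
  have := (norm_coeff_mul_pow_le hr.le j.lt_succ_self ((divQuot n u ^ k) b)).trans (key k _)
  rw [← le_div_iff₀ (by positivity), div_eq_mul_inv] at this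
  refine this.trans (le_of_eq (by ring))

end HypCurve

/-! ### Descent of unique solutions of linear systems to a subring. -/

namespace HypCurve

open Finset

/-- A linear system with coefficients in a subring `A` of a domain `B` whose solution is unique
over `B` has its solution in `A`, if `A` is closed under exact division. -/
theorem mem_of_sum_mul_mem {B : Type*} [CommRing B] [IsDomain B] (A : Subring B)
    (hdiv : ∀ a b, a ∈ A → a ≠ 0 → a * b ∈ A → b ∈ A) {ι κ : Type*} [Fintype ι] (c : ι → κ → B)
    (hc : ∀ i j, c i j ∈ A) (huniq : ∀ v : ι → B, (∀ j, ∑ i, v i * c i j = 0) → v = 0)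
    (a : ι → B) (ha : ∀ j, ∑ i, a i * c i j ∈ A) (i : ι) : a i ∈ A := by
  classical
  set K := FractionRing B
  set K₀ : Subfield K := Subfield.closure (algebraMap B K '' A)
  have hsub : ∀ x ∈ A, algebraMap B K x ∈ K₀ := fun x hx => Subfield.subset_closure ⟨x, hx, rfl⟩
  -- A K₀-linear retraction of K onto the field K₀ generated by A. It carries a solution of the
  -- system to a solution, so uniqueness forces the given one to have entries in K₀.
  obtain ⟨ρ, hρ⟩ := LinearMap.exists_leftInverse_of_injective (Algebra.linearMap K₀ K)
    (LinearMap.ker_eq_bot.2 (algebraMap K₀ K).injective)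
  have hρ' : ∀ x : K₀, ρ (x : K) = x := fun x => LinearMap.congr_fun hρ x
  -- Uniqueness passes from B to its fraction field by clearing a common denominator.
  have huniqK : ∀ v : ι → K, (∀ j, ∑ i, v i * algebraMap B K (c i j) = 0) → v = 0 := by
    intro v hv
    obtain ⟨d, hd⟩ := IsLocalization.exist_integer_multiples_of_finite (nonZeroDivisors B) v
    choose w hw using hd
    have hd0 : algebraMap B K d ≠ 0 := by
      simp
    have hw0 : w = 0 := huniq w fun j => by
      apply IsFractionRing.injective B K
      rw [map_sum, map_zero]
      simp only [map_mul, hw, Algebra.smul_def, mul_assoc]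
      rw [← mul_sum, hv j, mul_zero]
    ext i
    have := hw i
    rw [hw0, Pi.zero_apply, map_zero, Algebra.smul_def] at this
    simpa [hd0] using this.symm
  have hsol : (fun i => algebraMap B K (a i) - (ρ (algebraMap B K (a i)) : K)) = 0 := by
    refine huniqK _ fun j => ?_
    have h1 : ∑ i, (ρ (algebraMap B K (a i)) : K) * algebraMap B K (c i j) =
        (ρ (algebraMap B K (∑ i, a i * c i j)) : K) := by
      rw [map_sum, map_sum, AddSubmonoidClass.coe_finsetSum]
      refine sum_congr rfl fun i _ => ?_
      have : algebraMap B K (a i * c i j) =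
          (⟨_, hsub _ (hc i j)⟩ : K₀) • algebraMap B K (a i) := by
        rw [map_mul, mul_comm]; rfl
      rw [this, map_smul, smul_eq_mul, mul_comm]; rfl
    have h2 : (ρ (algebraMap B K (∑ i, a i * c i j)) : K) = algebraMap B K (∑ i, a i * c i j) :=
      congrArg Subtype.val (hρ' ⟨_, hsub _ (ha j)⟩)
    simp only [sub_mul, sum_sub_distrib]
    rw [h1, h2, map_sum, sub_eq_zero]
    exact sum_congr rfl fun i _ => (map_mul _ _ _).symm
  have hmem : algebraMap B K (a i) ∈ K₀ := by
    have := congrFun hsol i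
    rw [Pi.zero_apply, sub_eq_zero] at this
    rw [this]
    exact (ρ _).2
  have hcl : Subring.closure (algebraMap B K '' A) = A.map (algebraMap B K) := by
    rw [← Subring.coe_map, Subring.closure_eq]
  obtain ⟨y, hy, z, hz, hyz⟩ := Subfield.mem_closure_iff.1 hmem
  rw [hcl] at hy hz
  obtain ⟨p, hp, rfl⟩ := hy
  obtain ⟨q, hq, rfl⟩ := hz
  by_cases hq0 : q = 0
  · rw [hq0, map_zero, div_zero] at hyz
    have : a i = 0 := IsFractionRing.injective B K (by rw [← hyz, map_zero])
    rw [this]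
    exact A.zero_mem
  · refine hdiv q (a i) hq hq0 ?_
    have hq' : algebraMap B K q ≠ 0 := by simpa using hq0
    rw [div_eq_iff hq', ← map_mul] at hyz
    rwa [mul_comm, ← IsFractionRing.injective B K hyz]

end HypCurve

/-! ### Two-variable series as series in x over ℂ[[y]]. -/

namespace HypCurve

open Finset

/-- Series in two variables as series in the first variable whose coefficients are series in the
second one. -/
noncomputable def nestedEquiv :
    MvPowerSeries (Fin 2) ℂ ≃ₐ[ℂ] PowerSeries (PowerSeries ℂ) :=
  (MvPowerSeries.renameEquiv ℂ
    ((finSuccEquiv 1).trans (Equiv.optionCongr (Equiv.ofUnique (Fin 1) Unit)))).trans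
    (MvPowerSeries.optionEquivLeft Unit ℂ)

theorem coeff_coeff_nestedEquiv (f : MvPowerSeries (Fin 2) ℂ) (d : Fin 2 →₀ ℕ) :
    PowerSeries.coeff (d 1) (PowerSeries.coeff (d 0) (nestedEquiv f)) =
      MvPowerSeries.coeff d f := by
  have := MvPowerSeries.coeff_coeff_optionEquivLeft (MvPowerSeries.rename
    ((finSuccEquiv 1).trans (Equiv.optionCongr (Equiv.ofUnique (Fin 1) Unit))) f) (d 0)
    (Finsupp.single () (d 1))
  refine this.trans (Eq.trans ?_ (MvPowerSeries.coeff_embDomain_rename ((finSuccEquiv 1).trans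
    (Equiv.optionCongr (Equiv.ofUnique (Fin 1) Unit))).toEmbedding f d))
  congr 2
  ext x
  rcases x with _ | x
  · have : (none : Option Unit) = ((finSuccEquiv 1).trans
      (Equiv.optionCongr (Equiv.ofUnique (Fin 1) Unit))).toEmbedding 0 := by simp
    rw [this, Finsupp.embDomain_apply_self, ← this]; simp
  · have : (some x : Option Unit) = ((finSuccEquiv 1).trans
      (Equiv.optionCongr (Equiv.ofUnique (Fin 1) Unit))).toEmbedding 1 := rfl
    rw [this, Finsupp.embDomain_apply_self, ← this]; simp

theorem nestedEquiv_X_zero : nestedEquiv (MvPowerSeries.X 0) = PowerSeries.X := by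
  simp [nestedEquiv]

theorem nestedEquiv_toMvPowerSeries (a : PowerSeries ℂ) :
    nestedEquiv (PowerSeries.toMvPowerSeries 1 a) = PowerSeries.C a := by
  ext l k
  have h := coeff_coeff_nestedEquiv (PowerSeries.toMvPowerSeries 1 a)
    (Finsupp.single 0 l + Finsupp.single 1 k)
  simp only [Finsupp.add_apply, Finsupp.single_eq_same, ne_eq, zero_ne_one, one_ne_zero,
    not_false_eq_true, Finsupp.single_eq_of_ne, add_zero, zero_add] at h
  rw [h, PowerSeries.toMvPowerSeries_eq_subst, PowerSeries.coeff_subst_single, PowerSeries.coeff_C]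
  rcases l with _ | l
  · simp
  · rw [if_neg, if_neg (by omega), map_zero]
    intro h
    simpa using DFunLike.congr_fun h 0

end HypCurve

/-! ### From a convergent parametrization to a convergent equation. -/

namespace HypCurve

open Finset

/-- Orders add under multiplication, and a variable has order 1, which the nonunit f already uses
up. -/
theorem isUnit_of_X_eq_mul {f g : MvPowerSeries (Fin 2) ℂ} {i : Fin 2} (hf : ¬ IsUnit f)
    (h : MvPowerSeries.X i = f * g) : IsUnit g := by
  rw [MvPowerSeries.isUnit_iff_constantCoeff] at hf ⊢
  rw [isUnit_iff_ne_zero, not_not] at hf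
  rw [isUnit_iff_ne_zero]
  intro hg
  have h1 := congrArg MvPowerSeries.order h
  rw [MvPowerSeries.order_mul] at h1
  have hf1 : 1 ≤ f.order := MvPowerSeries.one_le_order_iff_constCoeff_eq_zero.2 hf
  have hg1 : 1 ≤ g.order := MvPowerSeries.one_le_order_iff_constCoeff_eq_zero.2 hg
  have hX : (MvPowerSeries.X i : MvPowerSeries (Fin 2) ℂ).order ≤ 1 := by
    have := MvPowerSeries.order_le (f := (MvPowerSeries.X i : MvPowerSeries (Fin 2) ℂ))
      (d := Finsupp.single i 1) (by simp [MvPowerSeries.coeff_X])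
    simpa using this
  have h2 : (1 : ℕ∞) + 1 ≤ 1 := (add_le_add hf1 hg1).trans (h1 ▸ hX)
  exact absurd h2 (by decide)

theorem isConvergent_of_norm_coeff_le {f : MvPowerSeries (Fin 2) ℂ} {m : ℕ} {M A : ℝ} (hA : 0 < A)
    (h0 : ∀ d : Fin 2 →₀ ℕ, m ≤ d 0 → MvPowerSeries.coeff d f = 0)
    (h : ∀ d : Fin 2 →₀ ℕ, ‖MvPowerSeries.coeff d f‖ ≤ M * A ^ d 1) : IsConvergent f := by
  refine ⟨(2 * A)⁻¹, by positivity, ?_⟩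
  have hM : 0 ≤ M := by simpa using (norm_nonneg _).trans (h 0)
  have hs1 : Summable fun i : ℕ => if i < m then ((2 * A)⁻¹) ^ i else 0 :=
    summable_of_ne_finset_zero (s := range m) fun i hi => if_neg (by simpa using hi)
  have hs2 : Summable fun j : ℕ => M * (1 / 2 : ℝ) ^ j :=
    (summable_geometric_of_lt_one (by norm_num) (by norm_num)).mul_left M
  have hs := hs1.mul_of_nonneg hs2 (fun i => by dsimp only; split_ifs <;> positivity)
    (fun j => by positivity)
  have hs' := (Equiv.summable_iff (Finsupp.equivFunOnFinite.trans (finTwoArrowEquiv ℕ))).2 hs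
  refine Summable.of_nonneg_of_le (fun d => by positivity) (fun d => ?_) hs'
  change _ ≤ (if d 0 < m then ((2 * A)⁻¹) ^ d 0 else 0) * (M * (1 / 2 : ℝ) ^ d 1)
  split_ifs with hd
  · calc _ ≤ M * A ^ d 1 * (2 * A)⁻¹ ^ (d 0 + d 1) := by gcongr; exact h d
      _ = (2 * A)⁻¹ ^ d 0 * (M * (A * (2 * A)⁻¹) ^ d 1) := by rw [pow_add, mul_pow]; ring
      _ = _ := by rw [show A * (2 * A)⁻¹ = 1 / 2 by field_simp]
  · rw [h0 d (not_lt.1 hd)]; simp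

theorem isConvergent_nestedEquiv_symm (p : Polynomial (PowerSeries ℂ))
    (hp : ∀ i, IsConvergentSeries (p.coeff i)) :
    IsConvergent (nestedEquiv.symm (p : PowerSeries (PowerSeries ℂ))) := by
  have hco : ∀ d : Fin 2 →₀ ℕ, MvPowerSeries.coeff d
      (nestedEquiv.symm (p : PowerSeries (PowerSeries ℂ))) =
        PowerSeries.coeff (d 1) (p.coeff (d 0)) := fun d => by
    rw [← coeff_coeff_nestedEquiv, AlgEquiv.apply_symm_apply, Polynomial.coeff_coe]
  choose M A hM hA h using fun i => (hp i).exists_norm_coeff_le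
  set m := p.natDegree + 1
  have h0 : ∀ d : Fin 2 →₀ ℕ, m ≤ d 0 → MvPowerSeries.coeff d
      (nestedEquiv.symm (p : PowerSeries (PowerSeries ℂ))) = 0 := fun d hd => by
    rw [hco, Polynomial.coeff_eq_zero_of_natDegree_lt (by omega), map_zero]
  have hApos : 0 < 1 + ∑ i ∈ range m, A i :=
    add_pos_of_pos_of_nonneg one_pos (sum_nonneg fun i _ => (hA i).le)
  refine isConvergent_of_norm_coeff_le (m := m) (M := ∑ i ∈ range m, M i)
    (A := 1 + ∑ i ∈ range m, A i) hApos h0 fun d => ?_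
  by_cases hd : d 0 < m
  · rw [hco]
    refine (h _ _).trans ?_
    have h1 : M (d 0) ≤ ∑ i ∈ range m, M i :=
      single_le_sum (fun i _ => hM i) (mem_range.2 hd)
    have h2 : A (d 0) ≤ ∑ i ∈ range m, A i :=
      single_le_sum (fun i _ => (hA i).le) (mem_range.2 hd)
    have h3 := (hA (d 0)).le
    have h4 := hM (d 0)
    have h5 : A (d 0) ≤ 1 + ∑ i ∈ range m, A i := by linarith
    have h6 := h4.trans h1
    gcongr
  · rw [h0 d (not_lt.1 hd), norm_zero]
    exact mul_nonneg (sum_nonneg fun i _ => hM i) (by positivity)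

theorem isConvergent_X (i : Fin 2) : IsConvergent (MvPowerSeries.X i) := by
  refine ⟨1, one_pos, summable_of_ne_finset_zero (s := {Finsupp.single i 1}) fun d hd => ?_⟩
  rw [MvPowerSeries.coeff_X, if_neg (by simpa using hd)]
  simp

section Parametrization

variable {γ : Fin 2 → PowerSeries ℂ}

theorem hasSubst_of_constantCoeff (h : ∀ i, PowerSeries.constantCoeff (γ i) = 0) :
    MvPowerSeries.HasSubst γ :=
  MvPowerSeries.hasSubst_of_constantCoeff_zero h

theorem subst_nestedEquiv_symm (h : ∀ i, PowerSeries.constantCoeff (γ i) = 0)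
    (p : Polynomial (PowerSeries ℂ)) :
    (MvPowerSeries.subst γ (nestedEquiv.symm (p : PowerSeries (PowerSeries ℂ))) :
      PowerSeries ℂ) =
      ∑ i ∈ range (p.natDegree + 1), PowerSeries.subst (γ 1) (p.coeff i) * γ 0 ^ i := by
  have hs := hasSubst_of_constantCoeff h
  have h1 : PowerSeries.HasSubst (γ 1) := .of_constantCoeff_zero' (h 1)
  have hC : ∀ a : PowerSeries ℂ, nestedEquiv.symm (PowerSeries.C a) =
      PowerSeries.toMvPowerSeries 1 a := fun a => by
    rw [← nestedEquiv_toMvPowerSeries, AlgEquiv.symm_apply_apply]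
  have hX : nestedEquiv.symm PowerSeries.X = MvPowerSeries.X 0 := by
    rw [← nestedEquiv_X_zero, AlgEquiv.symm_apply_apply]
  have key : ∀ p : Polynomial (PowerSeries ℂ),
      (MvPowerSeries.substAlgHom (R := ℂ) hs
        (nestedEquiv.symm (p : PowerSeries (PowerSeries ℂ))) : PowerSeries ℂ) =
      p.eval₂ ((PowerSeries.substAlgHom (R := ℂ) h1 : PowerSeries ℂ →ₐ[ℂ] PowerSeries ℂ) :
        PowerSeries ℂ →+* PowerSeries ℂ) (γ 0) := by
    intro p
    induction p using Polynomial.induction_on' with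
    | add p q hp hq => rw [Polynomial.coe_add, map_add, map_add, hp, hq, Polynomial.eval₂_add]
    | monomial i a =>
      rw [Polynomial.coe_monomial, PowerSeries.monomial_eq_C_mul_X_pow, map_mul, map_pow, hC, hX,
        map_mul, map_pow, MvPowerSeries.substAlgHom_X, Polynomial.eval₂_monomial,
        MvPowerSeries.substAlgHom_apply, PowerSeries.subst_toMvPowerSeries hs]
      congr 1
      exact (congrFun (PowerSeries.coe_substAlgHom h1) a).symm
  rw [← MvPowerSeries.substAlgHom_apply hs, key, Polynomial.eval₂_eq_sum_range]
  refine sum_congr rfl fun i _ => ?_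
  congr 1
  exact congrFun (PowerSeries.coe_substAlgHom h1) _

theorem subst_nestedEquiv_symm_of_degree_lt (h : ∀ i, PowerSeries.constantCoeff (γ i) = 0)
    {p : Polynomial (PowerSeries ℂ)} {m : ℕ} (hp : p.degree < m) :
    (MvPowerSeries.subst γ (nestedEquiv.symm (p : PowerSeries (PowerSeries ℂ))) :
      PowerSeries ℂ) =
      ∑ i ∈ range m, PowerSeries.subst (γ 1) (p.coeff i) * γ 0 ^ i := by
  have h1 : PowerSeries.HasSubst (γ 1) := .of_constantCoeff_zero' (h 1)
  have hz : PowerSeries.subst (γ 1) (0 : PowerSeries ℂ) = (0 : PowerSeries ℂ) := by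
    rw [← PowerSeries.coe_substAlgHom h1, map_zero]
  rw [subst_nestedEquiv_symm h]
  rcases le_total (p.natDegree + 1) m with hle | hle
  · refine sum_subset (range_mono hle) fun i _ hi => ?_
    rw [Polynomial.coeff_eq_zero_of_natDegree_lt (by simpa using hi), hz, zero_mul]
  · refine (sum_subset (range_mono hle) fun i _ hi => ?_).symm
    rw [Polynomial.degree_lt_iff_coeff_zero] at hp
    rw [hp i (by simpa using hi), hz, zero_mul]

/-- A formal curve with a convergent parametrization is analytic. -/
theorem isAnalyticCurve_of_convergent {Γ : Ideal (MvPowerSeries (Fin 2) ℂ)}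
    (hΓ : IsFormalCurve Γ) (hγ : IsParametrization Γ γ) (hconv : ∀ i, IsConvergentSeries (γ i)) :
    IsAnalyticCurve Γ := by
  obtain ⟨f, hf, rfl⟩ := hΓ
  have h0 := hγ.constantCoeff_eq_zero
  have hs := hasSubst_of_constantCoeff h0
  -- If the second component vanishes, y lies in Γ and is itself a generator.
  by_cases hγ1 : γ 1 = 0
  · have hX : MvPowerSeries.X 1 ∈ Ideal.span {f} := by
      rw [hγ.mem_iff, MvPowerSeries.subst_X hs, hγ1]
    obtain ⟨g, hg⟩ := Ideal.mem_span_singleton.1 hX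
    refine ⟨MvPowerSeries.X 1, isConvergent_X 1, ?_⟩
    rw [hg, Ideal.span_singleton_mul_right_unit (isUnit_of_X_eq_mul hf.not_isUnit hg)]
  -- Regularity in x, needed for Weierstrass preparation: otherwise y divides the irreducible f, so
  -- y generates Γ and γ₁ = 0.
  have hE : (nestedEquiv f).map (IsLocalRing.residue (PowerSeries ℂ)) ≠ 0 := by
    intro hzero
    have hdvd : PowerSeries.C (PowerSeries.X : PowerSeries ℂ) ∣ nestedEquiv f := by
      have : ∀ n, (PowerSeries.X : PowerSeries ℂ) ∣ PowerSeries.coeff n (nestedEquiv f) := by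
        intro n
        have h1 := congrArg (PowerSeries.coeff n) hzero
        rw [PowerSeries.coeff_map, map_zero, IsLocalRing.residue_eq_zero_iff,
          PowerSeries.maximalIdeal_eq_span_X, Ideal.mem_span_singleton] at h1
        exact h1
      choose h hh using this
      exact ⟨PowerSeries.mk h, by ext1 n; rw [PowerSeries.coeff_C_mul, PowerSeries.coeff_mk, hh]⟩
    obtain ⟨h, hh⟩ := hdvd
    have hf' : f = MvPowerSeries.X 1 * nestedEquiv.symm h := by
      apply nestedEquiv.injective
      rw [map_mul, AlgEquiv.apply_symm_apply, hh, ← nestedEquiv_toMvPowerSeries,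
        PowerSeries.toMvPowerSeries_X]
    rcases hf.isUnit_or_isUnit hf' with hu | hu
    · rw [MvPowerSeries.isUnit_iff_constantCoeff] at hu
      simp at hu
    · apply hγ1
      rw [← MvPowerSeries.subst_X (R := ℂ) hs 1, ← hγ.mem_iff, Ideal.mem_span_singleton]
      obtain ⟨v, hv⟩ := hu
      refine ⟨(v⁻¹ : (MvPowerSeries (Fin 2) ℂ)ˣ), ?_⟩
      rw [hf', ← hv, Units.mul_inv_cancel_right]
  have : IsAdicComplete (IsLocalRing.maximalIdeal (PowerSeries ℂ)) (PowerSeries ℂ) := by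
    rw [PowerSeries.maximalIdeal_eq_span_X]
    infer_instance
  obtain ⟨W, h, hW⟩ := PowerSeries.exists_isWeierstrassFactorization hE
  have hspan : Ideal.span {f} =
      Ideal.span {nestedEquiv.symm (W : PowerSeries (PowerSeries ℂ))} := by
    have : f = nestedEquiv.symm (W : PowerSeries (PowerSeries ℂ)) * nestedEquiv.symm h := by
      rw [← map_mul, ← hW.eq_mul, AlgEquiv.symm_apply_apply]
    rw [this, Ideal.span_singleton_mul_right_unit (hW.isUnit.map nestedEquiv.symm)]
  refine ⟨_, isConvergent_nestedEquiv_symm W ?_, hspan⟩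
  obtain ⟨n, u, hnu, hu⟩ := exists_eq_X_pow_mul hγ1
  have hn : n ≠ 0 := by
    rintro rfl
    apply hu
    rw [← h0 1, hnu, pow_zero, one_mul]
  have hmonic := hW.isDistinguishedAt.monic
  set m := W.natDegree with hm
  have hWγ : ∑ i ∈ range (m + 1), PowerSeries.subst (γ 1) (W.coeff i) * γ 0 ^ i = 0 := by
    rw [← subst_nestedEquiv_symm h0, ← hγ.mem_iff, hspan]
    exact Ideal.mem_span_singleton_self _
  have hucv : IsConvergentSeries u := (hnu ▸ hconv 1).of_X_pow_mul
  have hpow : ∀ k, IsConvergentSeries (γ 0 ^ k) := fun k => convergentSubring.pow_mem (hconv 0) k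
  -- A solution of the homogeneous system gives a polynomial in x of degree below m vanishing on
  -- `γ`. It is a multiple of f, so uniqueness of Weierstrass division makes it zero.
  have huniq : ∀ v : Fin m → PowerSeries ℂ,
      (∀ j : Fin n, ∑ i, v i * expansion n u j (γ 0 ^ (i : ℕ)) = 0) → v = 0 := by
    intro v hv
    set p : Polynomial (PowerSeries ℂ) := ∑ i : Fin m, Polynomial.monomial (i : ℕ) (v i) with hp
    have hpc : ∀ i : Fin m, p.coeff i = v i := fun i => by
      simp [hp, Polynomial.coeff_monomial, Fin.val_inj]
    have hpd : p.degree < m := by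
      rw [hp, Polynomial.degree_lt_iff_coeff_zero]
      intro k hk
      rw [Polynomial.finsetSum_coeff]
      refine sum_eq_zero fun i _ => ?_
      rw [Polynomial.coeff_monomial, if_neg (by omega)]
    have hp0 : ∑ i : Fin m, PowerSeries.subst (γ 1) (v i) * γ 0 ^ (i : ℕ) = 0 := by
      refine eq_zero_of_expansion_eq_zero hn hu fun j hj => ?_
      rw [map_sum, ← hv ⟨j, hj⟩]
      refine sum_congr rfl fun i _ => ?_
      rw [hnu, expansion_subst_mul hu hj]
    have hpΓ : nestedEquiv.symm (p : PowerSeries (PowerSeries ℂ)) ∈ Ideal.span {f} := by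
      rw [hγ.mem_iff, ← hp0, subst_nestedEquiv_symm_of_degree_lt h0 hpd, Fin.sum_univ_eq_sum_range
        (fun i => PowerSeries.subst (γ 1) (p.coeff i) * γ 0 ^ i) m |>.symm]
      exact sum_congr rfl fun i _ => by rw [hpc]
    obtain ⟨q, hq⟩ := Ideal.mem_span_singleton.1 hpΓ
    have hq' : nestedEquiv f * nestedEquiv q = p := by
      rw [← map_mul, ← hq, AlgEquiv.apply_symm_apply]
    have hdiv := PowerSeries.IsWeierstrassDivisor.of_map_ne_zero hE
    have hp00 := (hdiv.eq_zero_of_mul_eq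
      (by rw [hm, hW.natDegree_eq_toNat_order_map] at hpd; exact hpd) hq').2
    ext1 i
    rw [← hpc, hp00, Polynomial.coeff_zero, Pi.zero_apply]
  have hmem : ∀ i : Fin m, W.coeff i ∈ convergentSubring := by
    refine mem_of_sum_mul_mem convergentSubring (fun a b ha ha0 hab => ha.of_mul_left ha0 hab)
      (fun (i : Fin m) (j : Fin n) => expansion n u j (γ 0 ^ (i : ℕ))) ?_ huniq _ ?_
    · exact fun i j => hucv.expansion (hpow i) j
    · intro j
      -- The coordinates of W(γ) = 0, with the leading term moved to the right since W is monic.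
      have h1 : ∑ i : Fin m, W.coeff i * expansion n u j (γ 0 ^ (i : ℕ)) =
          -expansion n u j (γ 0 ^ m) := by
        rw [eq_neg_iff_add_eq_zero, Fin.sum_univ_eq_sum_range
          (fun i => W.coeff i * expansion n u j (γ 0 ^ i)) m]
        have h2 : W.coeff m * expansion n u j (γ 0 ^ m) = expansion n u j (γ 0 ^ m) := by
          rw [hm, hmonic.coeff_natDegree, one_mul]
        rw [← h2, ← sum_range_succ]
        have h3 := congrArg (expansion n u j) hWγ
        rw [map_sum, map_zero] at h3
        rw [← h3]
        refine sum_congr rfl fun i _ => ?_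
        rw [hnu, expansion_subst_mul hu j.2]
      rw [h1]
      exact convergentSubring.neg_mem (hucv.expansion (hpow m) j)
  intro i
  rcases lt_trichotomy i m with hi | hi | hi
  · exact hmem ⟨i, hi⟩
  · rw [hi, hm, hmonic.coeff_natDegree]
    exact convergentSubring.one_mem
  · rw [Polynomial.coeff_eq_zero_of_natDegree_lt hi]
    exact convergentSubring.zero_mem

end Parametrization

end HypCurve

/-! ### Taylor coefficients of analytic germs and Cauchy estimates. -/

namespace HypCurve

open Metric

theorem coeff_taylorSeries (f : (Fin 2 → ℂ) → ℂ) (d : Fin 2 →₀ ℕ) :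
    MvPowerSeries.coeff d (taylorSeries f) =
      iteratedDeriv (d 0) (fun x : ℂ => iteratedDeriv (d 1) (fun y : ℂ => f ![x, y]) 0) 0 /
        ((Nat.factorial (d 0) : ℂ) * (Nat.factorial (d 1) : ℂ)) := rfl

theorem hasDerivAt_vec_snd (x y : ℂ) : HasDerivAt (fun y : ℂ => ![x, y]) ![0, 1] y := by
  rw [hasDerivAt_pi]
  intro i
  fin_cases i
  · simpa using hasDerivAt_const y x
  · exact hasDerivAt_id' y

theorem hasDerivAt_vec_fst (x y : ℂ) : HasDerivAt (fun x : ℂ => ![x, y]) ![1, 0] x := by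
  rw [hasDerivAt_pi]
  intro i
  fin_cases i
  · exact hasDerivAt_id' x
  · simpa using hasDerivAt_const x y

/-- Joint analyticity of the y-derivatives makes them holomorphic in x, as the second Cauchy
estimate requires. Working on an open set lets the identity be differentiated again. -/
theorem exists_analyticOnNhd_iteratedDeriv_snd {f : (Fin 2 → ℂ) → ℂ} {U : Set (Fin 2 → ℂ)}
    (hU : IsOpen U) (hf : AnalyticOnNhd ℂ f U) (j : ℕ) :
    ∃ g : (Fin 2 → ℂ) → ℂ, AnalyticOnNhd ℂ g U ∧
      ∀ x y : ℂ, ![x, y] ∈ U → iteratedDeriv j (fun y : ℂ => f ![x, y]) y = g ![x, y] := by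
  induction j with
  | zero => exact ⟨f, hf, fun x y _ => by simp⟩
  | succ j ih =>
    obtain ⟨g, hg, hfg⟩ := ih
    refine ⟨fun z => fderiv ℂ g z ![0, 1], fun z hz => ?_, fun x y hxy => ?_⟩
    · exact (ContinuousLinearMap.apply ℂ ℂ (![0, 1] : Fin 2 → ℂ)).analyticAt _ |>.comp
        (hg.fderiv z hz)
    · rw [iteratedDeriv_succ]
      have hcont : ContinuousAt (fun y : ℂ => ![x, y]) y := (hasDerivAt_vec_snd x y).continuousAt
      have hev : iteratedDeriv j (fun y : ℂ => f ![x, y]) =ᶠ[nhds y] fun y => g ![x, y] := by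
        filter_upwards [hcont.preimage_mem_nhds (hU.mem_nhds hxy)] with y hy using hfg x y hy
      rw [hev.deriv_eq]
      exact ((hg _ hxy).differentiableAt.hasFDerivAt.comp_hasDerivAt y
        (hasDerivAt_vec_snd x y)).deriv

theorem norm_vec_le {x y : ℂ} {r : ℝ} (hx : ‖x‖ ≤ r) (hy : ‖y‖ ≤ r) : ‖![x, y]‖ ≤ r := by
  rw [pi_norm_le_iff_of_nonneg ((norm_nonneg x).trans hx)]
  intro i
  fin_cases i
  · exact hx
  · exact hy

/-- Cauchy estimates for the Taylor coefficients of an analytic germ. -/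
theorem exists_norm_coeff_taylorSeries_le {f : (Fin 2 → ℂ) → ℂ} (hf : AnalyticAt ℂ f 0) :
    ∃ M A : ℝ, 0 ≤ M ∧ 0 < A ∧ ∀ d : Fin 2 →₀ ℕ,
      ‖MvPowerSeries.coeff d (taylorSeries f)‖ ≤ M * A ^ (d 0 + d 1) := by
  have hb : ∀ᶠ z in nhds (0 : Fin 2 → ℂ), ‖f z‖ < ‖f 0‖ + 1 :=
    hf.continuousAt.norm.eventually_lt continuousAt_const (by linarith)
  obtain ⟨R, hR, hball⟩ := Metric.eventually_nhds_iff_ball.1 (hf.eventually_analyticAt.and hb)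
  set M := ‖f 0‖ + 1
  have hM : 0 ≤ M := by positivity
  set r := R / 2 with hr
  have hr0 : 0 < r := by positivity
  have hmem : ∀ x y : ℂ, ‖x‖ ≤ r → ‖y‖ ≤ r → ![x, y] ∈ ball (0 : Fin 2 → ℂ) R := by
    intro x y hx hy
    rw [mem_ball_zero_iff]
    exact (norm_vec_le hx hy).trans_lt (by linarith)
  refine ⟨M, r⁻¹, hM, by positivity, fun d => ?_⟩
  obtain ⟨g, hg, hfg⟩ := exists_analyticOnNhd_iteratedDeriv_snd isOpen_ball
    (fun z hz => (hball z hz).1) (d 1)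
  have h1 : ∀ x : ℂ, ‖x‖ ≤ r → ‖iteratedDeriv (d 1) (fun y : ℂ => f ![x, y]) 0‖ ≤
      (d 1).factorial * M / r ^ d 1 := by
    intro x hx
    refine Complex.norm_iteratedDeriv_le_of_forall_mem_sphere_norm_le _ hr0 ?_ ?_
    · refine DifferentiableOn.diffContOnCl fun y hy => ?_
      rw [closure_ball _ hr0.ne', mem_closedBall_zero_iff] at hy
      exact (((hball _ (hmem x y hx hy)).1.differentiableAt.hasFDerivAt.comp_hasDerivAt y
        (hasDerivAt_vec_snd x y)).differentiableAt).differentiableWithinAt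
    · intro y hy
      exact (hball _ (hmem x y hx (mem_sphere_zero_iff_norm.1 hy).le)).2.le
  -- Cauchy's estimate in x, fed with the estimate in y, which is uniform for ‖x‖ ≤ r.
  have h2 : ‖iteratedDeriv (d 0) (fun x : ℂ => iteratedDeriv (d 1) (fun y : ℂ => f ![x, y]) 0) 0‖ ≤
      (d 0).factorial * ((d 1).factorial * M / r ^ d 1) / r ^ d 0 := by
    refine Complex.norm_iteratedDeriv_le_of_forall_mem_sphere_norm_le _ hr0 ?_ ?_
    · refine DifferentiableOn.diffContOnCl (DifferentiableOn.congr
        (f := fun x => g ![x, 0]) (fun x hx => ?_) fun x hx => ?_)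
      all_goals rw [closure_ball _ hr0.ne', mem_closedBall_zero_iff] at hx
      · exact (((hg _ (hmem x 0 hx (by simpa using hr0.le))).differentiableAt.hasFDerivAt
          |>.comp_hasDerivAt x (hasDerivAt_vec_fst x 0)).differentiableAt).differentiableWithinAt
      · exact hfg x 0 (hmem x 0 hx (by simpa using hr0.le))
    · intro x hx
      exact h1 x (mem_sphere_zero_iff_norm.1 hx).le
  rw [coeff_taylorSeries, norm_div, norm_mul, Complex.norm_natCast, Complex.norm_natCast,
    div_le_iff₀ (by positivity)]
  refine h2.trans (le_of_eq ?_)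
  rw [pow_add, inv_pow, inv_pow]
  field_simp

theorem coeff_zero_taylorSeries (f : (Fin 2 → ℂ) → ℂ) :
    MvPowerSeries.coeff 0 (taylorSeries f) = f 0 := by
  have : (![0, 0] : Fin 2 → ℂ) = 0 := by ext i; fin_cases i <;> rfl
  simp [coeff_taylorSeries, this]

theorem coeff_single_taylorSeries {f : (Fin 2 → ℂ) → ℂ} (hf : DifferentiableAt ℂ f 0)
    (i : Fin 2) : MvPowerSeries.coeff (Finsupp.single i 1) (taylorSeries f) =
      fderiv ℂ f 0 (Pi.single i 1) := by
  have h00 : (![0, 0] : Fin 2 → ℂ) = 0 := by ext i; fin_cases i <;> rfl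
  rw [← h00] at hf
  rw [coeff_taylorSeries, ← h00]
  fin_cases i
  · have : (Pi.single 0 1 : Fin 2 → ℂ) = ![1, 0] := by ext i; fin_cases i <;> rfl
    simp only [Fin.zero_eta, Finsupp.single_eq_same, ne_eq, one_ne_zero, not_false_eq_true,
      Finsupp.single_eq_of_ne, iteratedDeriv_zero, iteratedDeriv_one, Nat.factorial,
      Nat.cast_one, mul_one, div_one, this]
    exact (hf.hasFDerivAt.comp_hasDerivAt (0 : ℂ) (hasDerivAt_vec_fst 0 0)).deriv
  · have : (Pi.single 1 1 : Fin 2 → ℂ) = ![0, 1] := by ext i; fin_cases i <;> rfl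
    simp only [Fin.mk_one, Finsupp.single_eq_same, ne_eq, zero_ne_one, not_false_eq_true,
      Finsupp.single_eq_of_ne, iteratedDeriv_zero, iteratedDeriv_one, Nat.factorial,
      Nat.cast_one, mul_one, div_one, this]
    exact (hf.hasFDerivAt.comp_hasDerivAt (0 : ℂ) (hasDerivAt_vec_snd 0 0)).deriv

theorem fderiv_apply_eq_sum {F : (Fin 2 → ℂ) → (Fin 2 → ℂ)} (hF : DifferentiableAt ℂ F 0)
    (v : Fin 2 → ℂ) (i : Fin 2) :
    fderiv ℂ F 0 v i =
      ∑ k, MvPowerSeries.coeff (Finsupp.single k 1) (formalMap F i) * v k := by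
  have hFi : ∀ i, DifferentiableAt ℂ (fun z => F z i) 0 := differentiableAt_pi.1 hF
  have h1 : fderiv ℂ F 0 v i = fderiv ℂ (fun z => F z i) 0 v := by
    rw [fderiv_pi hFi]; rfl
  have h2 : v = ∑ k, v k • (Pi.single k 1 : Fin 2 → ℂ) := by
    ext k
    simp [Finset.sum_apply, Pi.single_apply]
  rw [h1]
  conv_lhs => rw [h2]
  rw [map_sum]
  refine Finset.sum_congr rfl fun k _ => ?_
  rw [map_smul, smul_eq_mul, mul_comm, formalMap, coeff_single_taylorSeries (hFi i)]

end HypCurve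

/-! ### Convergence of formal solutions of F(γ(s)) = γ(λs). -/

namespace HypCurve

open PowerSeries Finset

/-- Hyperbolicity enters here. For |λ| < 1 the term λⁿ is eventually negligible against the
injective L; for |λ| > 1 it eventually exceeds ‖L‖ + 1. -/
theorem exists_le_norm_pow_smul_sub {E : Type*} [NormedAddCommGroup E] [NormedSpace ℂ E]
    [FiniteDimensional ℂ E] (L : E →L[ℂ] E) (hL : Function.Injective L) {lam : ℂ}
    (hlam : ‖lam‖ ≠ 1) :
    ∃ C : ℝ, 0 ≤ C ∧ ∃ N₀ : ℕ, ∀ n ≥ N₀, ∀ v, ‖v‖ ≤ C * ‖lam ^ n • v - L v‖ := by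
  rcases lt_or_gt_of_ne hlam with h | h
  · obtain ⟨K, hK, hKL⟩ := (L : E →ₗ[ℂ] E).exists_antilipschitzWith (LinearMap.ker_eq_bot.2 hL)
    have hKpos : (0 : ℝ) < K := hK
    obtain ⟨N₀, hN₀⟩ := exists_pow_lt_of_lt_one (by positivity : 0 < 1 / (2 * (K : ℝ))) h
    refine ⟨2 * K, by positivity, N₀, fun n hn v => ?_⟩
    have h1 : ‖v‖ ≤ K * ‖L v‖ := by
      have := hKL.le_mul_dist v 0
      simpa using this
    have h2 : ‖lam‖ ^ n ≤ 1 / (2 * (K : ℝ)) :=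
      (pow_le_pow_of_le_one (norm_nonneg _) h.le hn).trans hN₀.le
    have h3 : ‖L v‖ ≤ ‖lam‖ ^ n * ‖v‖ + ‖lam ^ n • v - L v‖ := by
      calc ‖L v‖ = ‖lam ^ n • v - (lam ^ n • v - L v)‖ := by rw [sub_sub_cancel]
        _ ≤ ‖lam ^ n • v‖ + ‖lam ^ n • v - L v‖ := norm_sub_le _ _
        _ = _ := by rw [norm_smul, norm_pow]
    have h4 : (K : ℝ) * (‖lam‖ ^ n * ‖v‖) ≤ ‖v‖ / 2 := by
      calc _ ≤ (K : ℝ) * (1 / (2 * (K : ℝ)) * ‖v‖) := by gcongr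
        _ = _ := by field_simp
    nlinarith [mul_le_mul_of_nonneg_left h3 hKpos.le]
  · obtain ⟨N₀, hN₀⟩ := pow_unbounded_of_one_lt (‖L‖ + 1) h
    refine ⟨1, zero_le_one, N₀, fun n hn v => ?_⟩
    have h2 : ‖L‖ + 1 ≤ ‖lam‖ ^ n := hN₀.le.trans (pow_le_pow_right₀ h.le hn)
    have h3 : ‖lam‖ ^ n * ‖v‖ - ‖L v‖ ≤ ‖lam ^ n • v - L v‖ := by
      rw [← norm_pow, ← norm_smul]; exact norm_sub_norm_le _ _
    have h4 := L.le_opNorm v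
    have h5 := mul_le_mul_of_nonneg_right h2 (norm_nonneg v)
    linarith

/-- Exponents of monomials in two variables as pairs of natural numbers. -/
noncomputable def exponent : ℕ × ℕ ≃ (Fin 2 →₀ ℕ) :=
  (Finsupp.equivFunOnFinite.trans (finTwoArrowEquiv ℕ)).symm

theorem exponent_zero (p : ℕ × ℕ) : exponent p 0 = p.1 := rfl

theorem exponent_one (p : ℕ × ℕ) : exponent p 1 = p.2 := rfl

theorem coeff_pow_mul_pow_eq_zero {a b : PowerSeries ℂ} (ha : constantCoeff a = 0)
    (hb : constantCoeff b = 0) {i j n : ℕ} (h : n < i + j) : coeff n (a ^ i * b ^ j) = 0 := by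
  have h1 : X ^ (i + j) ∣ a ^ i * b ^ j := by
    rw [pow_add]
    exact mul_dvd_mul (pow_dvd_pow_of_dvd (X_dvd_iff.2 ha) _)
      (pow_dvd_pow_of_dvd (X_dvd_iff.2 hb) _)
  exact X_pow_dvd_iff.1 h1 n h

variable {γ : Fin 2 → PowerSeries ℂ}

theorem coeff_subst_eq_sum (h : ∀ i, constantCoeff (γ i) = 0) (f : MvPowerSeries (Fin 2) ℂ)
    {n N : ℕ} (hn : n < N) :
    coeff n (MvPowerSeries.subst γ f : PowerSeries ℂ) = ∑ p ∈ range N ×ˢ range N,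
      MvPowerSeries.coeff (exponent p) f * coeff n (γ 0 ^ p.1 * γ 1 ^ p.2) := by
  rw [PowerSeries.coeff, MvPowerSeries.coeff_subst (hasSubst_of_constantCoeff h),
    ← finsum_comp_equiv exponent]
  have hterm : ∀ p : ℕ × ℕ, MvPowerSeries.coeff (exponent p) f •
      MvPowerSeries.coeff (Finsupp.single () n) ((exponent p).prod fun s e => γ s ^ e) =
      MvPowerSeries.coeff (exponent p) f * coeff n (γ 0 ^ p.1 * γ 1 ^ p.2) := fun p => by
    rw [Finsupp.prod_fintype _ _ (fun i => pow_zero _), Fin.prod_univ_two, smul_eq_mul]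
    rfl
  simp only [hterm]
  refine finsum_eq_sum_of_support_subset _ fun p hp => ?_
  by_contra hlt
  refine hp ?_
  dsimp only
  rw [coeff_pow_mul_pow_eq_zero (h 0) (h 1), mul_zero]
  simp only [coe_product, Set.mem_prod, mem_coe, mem_range] at hlt
  omega

theorem sum_box_eq {M : Type*} [AddCommMonoid M] {N : ℕ} (hN : 2 ≤ N) (G : ℕ × ℕ → M) :
    ∑ p ∈ range N ×ˢ range N, G p = G (0, 0) + (G (1, 0) + G (0, 1)) +
      ∑ p ∈ range N ×ˢ range N with 2 ≤ p.1 + p.2, G p := by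
  rw [← sum_filter_not_add_sum_filter _ (fun p : ℕ × ℕ => 2 ≤ p.1 + p.2)]
  congr 1
  have : (range N ×ˢ range N).filter (fun p : ℕ × ℕ => ¬ 2 ≤ p.1 + p.2) =
      {(0, 0), (1, 0), (0, 1)} := by
    ext ⟨i, j⟩
    simp only [mem_filter, mem_product, mem_range, mem_insert, mem_singleton, Prod.mk.injEq]
    omega
  rw [this]
  simp

/-- The contribution of the monomials of degree between two and `2 * N` to the coefficient of
order `n` of `f ∘ γ`. -/
noncomputable def nonlinearCoeff (γ : Fin 2 → PowerSeries ℂ) (f : MvPowerSeries (Fin 2) ℂ)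
    (N n : ℕ) : ℂ :=
  ∑ p ∈ range N ×ˢ range N with 2 ≤ p.1 + p.2,
    MvPowerSeries.coeff (exponent p) f * coeff n (γ 0 ^ p.1 * γ 1 ^ p.2)

theorem coeff_subst_eq_linear_add (h : ∀ i, constantCoeff (γ i) = 0)
    {f : MvPowerSeries (Fin 2) ℂ} (hf : MvPowerSeries.coeff 0 f = 0) {n N : ℕ} (hn : n < N)
    (hN : 2 ≤ N) : coeff n (MvPowerSeries.subst γ f : PowerSeries ℂ) =
      ∑ k, MvPowerSeries.coeff (Finsupp.single k 1) f * coeff n (γ k) +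
        nonlinearCoeff γ f N n := by
  have h0 : exponent (0, 0) = 0 := by ext i; fin_cases i <;> rfl
  have h1 : exponent (1, 0) = Finsupp.single 0 1 := by
    ext i; fin_cases i <;> simp [exponent_zero, exponent_one]
  have h2 : exponent (0, 1) = Finsupp.single 1 1 := by
    ext i; fin_cases i <;> simp [exponent_zero, exponent_one]
  rw [coeff_subst_eq_sum h f hn, sum_box_eq hN, nonlinearCoeff, h0, h1, h2, hf,
    Fin.sum_univ_two]
  simp

/-- A monomial of degree at least 2 is a product of two factors without constant term, so its
coefficients through order K see only those of `γ` below K. -/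
theorem partialNorm_succ_monomial_le (h : ∀ i, constantCoeff (γ i) = 0) {r ε : ℝ} (hr : 0 ≤ r)
    {K : ℕ} (hK : ∀ i, partialNorm r K (γ i) ≤ ε) {i j : ℕ} (hij : 2 ≤ i + j) :
    partialNorm r (K + 1) (γ 0 ^ i * γ 1 ^ j) ≤ ε ^ (i + j) := by
  have hε : 0 ≤ ε := (partialNorm_nonneg hr _ _).trans (hK 0)
  have hpow : ∀ (k : Fin 2) (i : ℕ), partialNorm r K (γ k ^ i) ≤ ε ^ i := fun k i =>
    (partialNorm_pow_le hr K _ i).trans (pow_le_pow_left₀ (partialNorm_nonneg hr _ _) (hK k) i)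
  have hmul : ∀ i j : ℕ, partialNorm r K (γ 0 ^ i * γ 1 ^ j) ≤ ε ^ i * ε ^ j := fun i j =>
    (partialNorm_mul_le hr K _ _).trans
      (mul_le_mul (hpow 0 i) (hpow 1 j) (partialNorm_nonneg hr _ _) (by positivity))
  rcases i with _ | i
  · obtain ⟨j, rfl⟩ : ∃ j', j = j' + 2 := ⟨j - 2, by omega⟩
    rw [pow_zero, one_mul, pow_succ', zero_add, pow_succ' ε]
    refine (partialNorm_succ_mul_le hr K (h 1) (by simp [h 1])).trans ?_
    exact mul_le_mul (hK 1) (hpow 1 _) (partialNorm_nonneg hr _ _) hε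
  · rw [pow_succ', mul_assoc, show i + 1 + j = (i + j) + 1 by ring, pow_succ' ε, pow_add]
    refine (partialNorm_succ_mul_le hr K (h 0) ?_).trans ?_
    · rcases i with _ | i
      · simp [h 1, show j ≠ 0 by omega]
      · simp [h 0]
    · exact mul_le_mul (hK 0) (hmul _ _) (partialNorm_nonneg hr _ _) hε

theorem sum_pow_add_le {q : ℝ} (hq : 0 ≤ q) (hq2 : q ≤ 1 / 2) (N : ℕ) :
    ∑ p ∈ range N ×ˢ range N with 2 ≤ p.1 + p.2, q ^ (p.1 + p.2) ≤ 16 * q ^ 2 := by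
  have hgeom : ∑ i ∈ range N, (1 / 2 : ℝ) ^ i ≤ 2 := by
    rw [geom_sum_eq (by norm_num), div_le_iff_of_neg (by norm_num)]
    have : (0 : ℝ) < (1 / 2) ^ N := by positivity
    linarith
  calc _ ≤ ∑ p ∈ range N ×ˢ range N with 2 ≤ p.1 + p.2,
        4 * q ^ 2 * ((1 / 2) ^ p.1 * (1 / 2) ^ p.2) := by
        refine sum_le_sum fun p hp => ?_
        obtain ⟨m, hm⟩ := Nat.exists_eq_add_of_le (mem_filter.1 hp).2
        rw [← pow_add, hm, pow_add, pow_add (1 / 2 : ℝ)]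
        have : q ^ m ≤ (1 / 2) ^ m := pow_le_pow_left₀ hq hq2 m
        nlinarith [sq_nonneg q, mul_le_mul_of_nonneg_left this (sq_nonneg q)]
    _ ≤ ∑ p ∈ range N ×ˢ range N, 4 * q ^ 2 * ((1 / 2) ^ p.1 * (1 / 2) ^ p.2) :=
        sum_le_sum_of_subset_of_nonneg (filter_subset _ _) fun _ _ _ => by positivity
    _ = 4 * q ^ 2 * ((∑ i ∈ range N, (1 / 2 : ℝ) ^ i) * ∑ i ∈ range N, (1 / 2 : ℝ) ^ i) := by
        rw [sum_mul_sum, ← sum_product', ← mul_sum]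
    _ ≤ 4 * q ^ 2 * (2 * 2) := by
        have h0 : 0 ≤ ∑ i ∈ range N, (1 / 2 : ℝ) ^ i := sum_nonneg fun _ _ => by positivity
        gcongr
    _ = _ := by ring

theorem sum_norm_nonlinearCoeff_le (h : ∀ i, constantCoeff (γ i) = 0)
    {f : MvPowerSeries (Fin 2) ℂ} {M A : ℝ} (hM : 0 ≤ M) (hA : 0 ≤ A)
    (hf : ∀ d : Fin 2 →₀ ℕ, ‖MvPowerSeries.coeff d f‖ ≤ M * A ^ (d 0 + d 1)) {r ε : ℝ}
    (hr : 0 ≤ r) (hε : A * ε ≤ 1 / 2) {K : ℕ} (hK : ∀ i, partialNorm r K (γ i) ≤ ε) :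
    ∑ n ∈ range (K + 1), ‖nonlinearCoeff γ f (K + 1) n‖ * r ^ n ≤ M * (16 * (A * ε) ^ 2) := by
  have hε0 : 0 ≤ ε := (partialNorm_nonneg hr _ _).trans (hK 0)
  calc _ ≤ ∑ n ∈ range (K + 1), ∑ p ∈ range (K + 1) ×ˢ range (K + 1) with 2 ≤ p.1 + p.2,
        M * A ^ (p.1 + p.2) * (‖coeff n (γ 0 ^ p.1 * γ 1 ^ p.2)‖ * r ^ n) := by
        refine sum_le_sum fun n _ => ?_
        calc _ ≤ (∑ p ∈ range (K + 1) ×ˢ range (K + 1) with 2 ≤ p.1 + p.2,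
              ‖MvPowerSeries.coeff (exponent p) f * coeff n (γ 0 ^ p.1 * γ 1 ^ p.2)‖) * r ^ n := by
              gcongr; exact norm_sum_le _ _
          _ ≤ _ := by
              rw [sum_mul]
              refine sum_le_sum fun p _ => ?_
              rw [norm_mul, mul_assoc]
              gcongr
              exact hf _
    _ = ∑ p ∈ range (K + 1) ×ˢ range (K + 1) with 2 ≤ p.1 + p.2,
        M * A ^ (p.1 + p.2) * partialNorm r (K + 1) (γ 0 ^ p.1 * γ 1 ^ p.2) := by
        rw [sum_comm]
        simp only [partialNorm, mul_sum]
    _ ≤ ∑ p ∈ range (K + 1) ×ˢ range (K + 1) with 2 ≤ p.1 + p.2, M * (A * ε) ^ (p.1 + p.2) := by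
        refine sum_le_sum fun p hp => ?_
        rw [mul_pow, ← mul_assoc]
        gcongr
        exact partialNorm_succ_monomial_le h hr hK (mem_filter.1 hp).2
    _ ≤ _ := by
        rw [← mul_sum]
        gcongr
        exact sum_pow_add_le (by positivity) hε _

/-- A formal solution of `φ ∘ γ = γ(lam * s)` with `φ` convergent, of invertible linear part, and
`‖lam‖ ≠ 1`, is convergent. -/
theorem isConvergentSeries_of_semiconj {φ : Fin 2 → MvPowerSeries (Fin 2) ℂ} {M A : ℝ}
    (hM : 0 ≤ M) (hA : 0 ≤ A)
    (hφ : ∀ i, ∀ d : Fin 2 →₀ ℕ, ‖MvPowerSeries.coeff d (φ i)‖ ≤ M * A ^ (d 0 + d 1))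
    (hφ0 : ∀ i, MvPowerSeries.coeff 0 (φ i) = 0) (L : (Fin 2 → ℂ) →L[ℂ] (Fin 2 → ℂ))
    (hL : Function.Injective L)
    (hLφ : ∀ v i, L v i = ∑ k, MvPowerSeries.coeff (Finsupp.single k 1) (φ i) * v k)
    (hγ : ∀ i, constantCoeff (γ i) = 0) {lam : ℂ} (hlam : ‖lam‖ ≠ 1)
    (heq : ∀ i n, coeff n (MvPowerSeries.subst γ (φ i) : PowerSeries ℂ) =
      lam ^ n * coeff n (γ i)) (i : Fin 2) : IsConvergentSeries (γ i) := by
  obtain ⟨C, hC, N₀, hN₀⟩ := exists_le_norm_pow_smul_sub L hL hlam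
  set v : ℕ → Fin 2 → ℂ := fun n i => coeff n (γ i) with hv
  have hv0 : v 0 = 0 := by ext i; simp [hv, hγ i]
  set S := ∑ n ∈ range N₀, ‖v n‖ with hS
  have hS0 : 0 ≤ S := sum_nonneg fun _ _ => norm_nonneg _
  -- Chosen so that Aε ≤ 1/2, for the geometric sums, and 64CMA²ε ≤ 1, which bounds the nonlinear
  -- contribution 2·16·CM(Aε)² by ε/2.
  set ε : ℝ := (2 * A + 64 * C * M * A ^ 2 + 1)⁻¹ with hε
  have hε0 : 0 < ε := by positivity
  have hden : ε * (2 * A + 64 * C * M * A ^ 2 + 1) = 1 := inv_mul_cancel₀ (by positivity)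
  have hCMA : 0 ≤ ε * (64 * C * M * A ^ 2) := by positivity
  have hAε0 : 0 ≤ ε * A := by positivity
  have hAε : A * ε ≤ 1 / 2 := by linarith
  have hCε : 64 * C * M * A ^ 2 * ε ≤ 1 := by linarith
  -- Small enough that the first N₀ coefficients, where λⁿ − L is not controlled, contribute at most
  -- ε/2; there is no constant term, so each carries a factor r.
  set r : ℝ := min 1 (ε / (2 * (S + 1))) with hr
  have hr0 : 0 < r := by positivity
  have hsmall : ∑ n ∈ range N₀, ‖v n‖ * r ^ n ≤ ε / 2 := by
    calc _ ≤ ∑ n ∈ range N₀, ‖v n‖ * r := by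
          refine sum_le_sum fun n _ => ?_
          rcases n with _ | n
          · simp [hv0]
          · gcongr
            exact pow_le_of_le_one hr0.le (min_le_left _ _) (by omega)
      _ = S * r := by rw [← sum_mul]
      _ ≤ S * (ε / (2 * (S + 1))) := by gcongr; exact min_le_right _ _
      _ ≤ (S + 1) * (ε / (2 * (S + 1))) := by gcongr; linarith
      _ = ε / 2 := by field_simp
  have hle : ∀ i N, partialNorm r N (γ i) ≤ ∑ n ∈ range N, ‖v n‖ * r ^ n := fun i N =>
    sum_le_sum fun n _ => mul_le_mul_of_nonneg_right (norm_le_pi_norm (v n) i) (by positivity)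
  have key : ∀ N, ∑ n ∈ range N, ‖v n‖ * r ^ n ≤ ε := by
    intro N
    induction N with
    | zero => simpa using hε0.le
    | succ K ih =>
      rcases K with _ | K
      · simpa [hv0] using hε0.le
      set N := K + 1 + 1 with hN
      have hterm : ∀ n ∈ range N, ‖v n‖ * r ^ n ≤ (if n < N₀ then ‖v n‖ * r ^ n else 0) +
          C * ∑ i, ‖nonlinearCoeff γ (φ i) N n‖ * r ^ n := by
        intro n hn
        have hnn : 0 ≤ C * ∑ i, ‖nonlinearCoeff γ (φ i) N n‖ * r ^ n :=
          mul_nonneg hC (sum_nonneg fun _ _ => by positivity)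
        split_ifs with h
        · linarith
        · rw [zero_add, ← sum_mul, ← mul_assoc]
          gcongr
          refine (hN₀ n (not_lt.1 h) (v n)).trans ?_
          gcongr
          -- The equation at order n, with the linear part of φ moved to the left.
          have : lam ^ n • v n - L (v n) = fun i => nonlinearCoeff γ (φ i) N n := by
            ext i
            have h1 := heq i n
            rw [coeff_subst_eq_linear_add hγ (hφ0 i) (mem_range.1 hn) (by omega)] at h1
            rw [Pi.sub_apply, Pi.smul_apply, hLφ, smul_eq_mul, ← h1, add_sub_cancel_left]
          rw [this]
          exact (pi_norm_le_iff_of_nonneg (sum_nonneg fun _ _ => norm_nonneg _)).2 fun i =>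
            single_le_sum (f := fun i => ‖nonlinearCoeff γ (φ i) N n‖)
              (fun _ _ => norm_nonneg _) (mem_univ i)
      refine (sum_le_sum hterm).trans ?_
      rw [sum_add_distrib, ← mul_sum, sum_comm]
      have h1 : ∑ n ∈ range N, (if n < N₀ then ‖v n‖ * r ^ n else 0) ≤ ε / 2 := by
        rw [← sum_filter]
        refine le_trans (sum_le_sum_of_subset_of_nonneg ?_ fun _ _ _ => by positivity) hsmall
        intro n hn
        exact mem_range.2 (mem_filter.1 hn).2
      have h2 : ∑ i, ∑ n ∈ range N, ‖nonlinearCoeff γ (φ i) N n‖ * r ^ n ≤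
          ∑ _i : Fin 2, M * (16 * (A * ε) ^ 2) :=
        sum_le_sum fun i _ => sum_norm_nonlinearCoeff_le hγ hM hA (hφ i) hr0.le hAε
          fun i => (hle i _).trans ih
      rw [sum_const, card_univ, Fintype.card_fin] at h2
      have h3 := mul_le_mul_of_nonneg_left h2 hC
      have h4 : C * (2 • (M * (16 * (A * ε) ^ 2))) = (64 * C * M * A ^ 2 * ε) * (ε / 2) := by
        rw [nsmul_eq_mul]; push_cast; ring
      have h5 : (64 * C * M * A ^ 2 * ε) * (ε / 2) ≤ 1 * (ε / 2) := by gcongr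
      linarith
  exact ⟨r, hr0, ε, fun N => (hle i N).trans (key N)⟩

end HypCurve

/-! ### Formal linearization, changes of parameter and the conclusion. -/

namespace HypCurve

open PowerSeries Finset

section Linearization

/-- If a − b is divisible by Xⁿ, the difference of the d-th powers gains a further factor X, as a
and b have no constant term and d ≥ 2. This makes the linearization recursion triangular. -/
theorem coeff_pow_congr {a b : PowerSeries ℂ} (ha : constantCoeff a = 0)
    (hb : constantCoeff b = 0) {n : ℕ} (h : ∀ k < n, coeff k a = coeff k b) {d : ℕ}
    (hd : 2 ≤ d) : coeff n (a ^ d) = coeff n (b ^ d) := by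
  obtain ⟨d, rfl⟩ : ∃ d', d = d' + 2 := ⟨d - 2, by omega⟩
  have hab : X ^ n ∣ a - b := X_pow_dvd_iff.2 fun k hk => by rw [map_sub, h k hk, sub_self]
  have hpow : X ^ n ∣ a ^ (d + 1) - b ^ (d + 1) := hab.trans (sub_dvd_pow_sub_pow _ _ _)
  have hXb : X ∣ b ^ (d + 1) := dvd_pow (X_dvd_iff.2 hb) (by omega)
  have : X ^ (n + 1) ∣ a ^ (d + 2) - b ^ (d + 2) := by
    have hsplit : a ^ (d + 2) - b ^ (d + 2) =
        (a ^ (d + 1) - b ^ (d + 1)) * a + (a - b) * b ^ (d + 1) := by ring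
    rw [hsplit, pow_succ X]
    exact dvd_add (mul_dvd_mul hpow (X_dvd_iff.2 ha)) (mul_dvd_mul hab hXb)
  have h0 := X_pow_dvd_iff.1 this n n.lt_succ_self
  rwa [map_sub, sub_eq_zero] at h0

theorem coeff_subst_congr {a b η : PowerSeries ℂ} (ha : constantCoeff a = 0)
    (hb : constantCoeff b = 0) (h0 : coeff 0 η = 0) (h1 : coeff 1 η = 0) {n : ℕ}
    (h : ∀ k < n, coeff k a = coeff k b) :
    coeff n (PowerSeries.subst a η : PowerSeries ℂ) =
      coeff n (PowerSeries.subst b η : PowerSeries ℂ) := by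
  rw [PowerSeries.coeff_subst' (.of_constantCoeff_zero' ha),
    PowerSeries.coeff_subst' (.of_constantCoeff_zero' hb)]
  refine finsum_congr fun d => ?_
  rcases d with _ | _ | d
  · rw [h0, zero_smul, zero_smul]
  · rw [h1, zero_smul, zero_smul]
  · rw [coeff_pow_congr ha hb h (by omega)]

/-- The coefficients of the formal linearization of `lam * X + η`. -/
noncomputable def linearizationCoeff (η : PowerSeries ℂ) (lam : ℂ) (n : ℕ) : ℂ :=
  if n = 0 then 0 else if n = 1 then 1 else
    coeff n (PowerSeries.subst
      (PowerSeries.mk fun k => if _h : k < n then linearizationCoeff η lam k else 0) η :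
        PowerSeries ℂ) / (lam ^ n - lam)

/-- Formal Koenigs linearization. -/
theorem exists_formal_linearization {θ : PowerSeries ℂ} {lam : ℂ} (h0 : constantCoeff θ = 0)
    (h1 : coeff 1 θ = lam) (hlam : ∀ n, 2 ≤ n → lam ^ n ≠ lam) :
    ∃ φ : PowerSeries ℂ, constantCoeff φ = 0 ∧ coeff 1 φ = 1 ∧
      (PowerSeries.subst φ θ : PowerSeries ℂ) = rescale lam φ := by
  set η : PowerSeries ℂ := θ - lam • X with hη
  have hη0 : coeff 0 η = 0 := by simp [hη, h0]
  have hη1 : coeff 1 η = 0 := by simp [hη, h1]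
  set φ : PowerSeries ℂ := PowerSeries.mk (linearizationCoeff η lam) with hφ
  have hφ0 : constantCoeff φ = 0 := by
    rw [← coeff_zero_eq_constantCoeff_apply, hφ, coeff_mk, linearizationCoeff, if_pos rfl]
  have hφ1 : coeff 1 φ = 1 := by
    rw [hφ, coeff_mk, linearizationCoeff, if_neg one_ne_zero, if_pos rfl]
  have hs : PowerSeries.HasSubst φ := .of_constantCoeff_zero' hφ0
  have hsub : (PowerSeries.subst φ θ : PowerSeries ℂ) = PowerSeries.subst φ η + lam • φ := by
    have : θ = η + lam • X := by rw [hη, sub_add_cancel]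
    conv_lhs => rw [this]
    rw [PowerSeries.subst_add hs, PowerSeries.subst_smul hs, PowerSeries.subst_X hs]
  refine ⟨φ, hφ0, hφ1, ?_⟩
  ext n
  rw [hsub, map_add, coeff_rescale, coeff_smul, smul_eq_mul]
  rcases lt_or_ge n 2 with hn | hn
  · have hz : coeff n (PowerSeries.subst φ η : PowerSeries ℂ) = 0 := by
      rw [coeff_subst_congr hφ0 (map_zero _) hη0 hη1 (b := 0) fun k hk => ?_]
      · rw [PowerSeries.subst_zero_of_constantCoeff_zero
          (by rwa [← coeff_zero_eq_constantCoeff_apply]), map_zero]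
      · obtain rfl : k = 0 := by omega
        simpa using hφ0
    rw [hz, zero_add]
    interval_cases n
    · simp [hφ0]
    · simp
  · have hne : lam ^ n - lam ≠ 0 := sub_ne_zero.2 (hlam n hn)
    -- The recursion used a truncation of φ below order n; η has order at least 2, so the full φ
    -- gives the same coefficient.
    have hrec : coeff n φ * (lam ^ n - lam) = coeff n (PowerSeries.subst φ η : PowerSeries ℂ) := by
      rw [hφ, coeff_mk, linearizationCoeff, if_neg (by omega), if_neg (by omega),
        div_mul_cancel₀ _ hne, ← hφ]
      refine coeff_subst_congr ?_ hφ0 hη0 hη1 fun k hk => ?_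
      · rw [← coeff_zero_eq_constantCoeff_apply, coeff_mk, dif_pos (by omega), linearizationCoeff,
          if_pos rfl]
      · rw [coeff_mk, dif_pos hk, hφ, coeff_mk]
    rw [← hrec]; ring

end Linearization

section Reparametrization

variable {γ : Fin 2 → PowerSeries ℂ} {φ : PowerSeries ℂ}

theorem subst_subst_eq (hγ : ∀ i, constantCoeff (γ i) = 0) (hφ : constantCoeff φ = 0)
    (h : MvPowerSeries (Fin 2) ℂ) :
    (MvPowerSeries.subst (fun i => (PowerSeries.subst φ (γ i) : PowerSeries ℂ)) h :
      PowerSeries ℂ) = PowerSeries.subst φ (MvPowerSeries.subst γ h : PowerSeries ℂ) :=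
  (MvPowerSeries.subst_comp_subst_apply (hasSubst_of_constantCoeff hγ)
    (PowerSeries.HasSubst.const (.of_constantCoeff_zero' hφ)) h).symm

/-- Such a φ has a compositional inverse, so a change of parameter preserves the ideal of series
vanishing on `γ`. -/
theorem subst_eq_zero_iff (hφ : constantCoeff φ = 0) (hφ1 : coeff 1 φ ≠ 0) {a : PowerSeries ℂ} :
    (PowerSeries.subst φ a : PowerSeries ℂ) = 0 ↔ a = 0 := by
  have hs : PowerSeries.HasSubst φ := .of_constantCoeff_zero' hφ
  have hu : IsUnit (coeff 1 φ) := isUnit_iff_ne_zero.2 hφ1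
  have hinv := PowerSeries.HasSubst.substInvOfIsUnit φ hu
  constructor
  · intro h
    have h1 : (PowerSeries.subst (φ.substInvOfIsUnit hu) (PowerSeries.subst φ a : PowerSeries ℂ) :
        PowerSeries ℂ) = a := by
      rw [PowerSeries.subst_comp_subst_apply hs hinv,
        PowerSeries.subst_substInvOfIsUnit_right φ hφ hu, PowerSeries.X_subst]
    rw [← h1, h, ← PowerSeries.coe_substAlgHom hinv, map_zero]
  · rintro rfl
    rw [← PowerSeries.coe_substAlgHom hs, map_zero]

theorem IsParametrization.comp {Γ : Ideal (MvPowerSeries (Fin 2) ℂ)} (hγ : IsParametrization Γ γ)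
    (hφ : constantCoeff φ = 0) (hφ1 : coeff 1 φ ≠ 0) :
    IsParametrization Γ fun i => (PowerSeries.subst φ (γ i) : PowerSeries ℂ) where
  ne_zero h := hγ.ne_zero <| funext fun i => (subst_eq_zero_iff hφ hφ1).1 (congrFun h i)
  constantCoeff_eq_zero i := PowerSeries.constantCoeff_subst_eq_zero hφ _
    (hγ.constantCoeff_eq_zero i)
  mem_iff h := by
    rw [hγ.mem_iff, subst_subst_eq hγ.constantCoeff_eq_zero hφ, subst_eq_zero_iff hφ hφ1]

end Reparametrization

theorem subst_rescale_eq {φ : PowerSeries ℂ} (hφ : constantCoeff φ = 0) (lam : ℂ)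
    (a : PowerSeries ℂ) : (PowerSeries.subst (rescale lam φ) a : PowerSeries ℂ) =
      rescale lam (PowerSeries.subst φ a) := by
  rw [PowerSeries.rescale_eq_subst, PowerSeries.rescale_eq_subst,
    PowerSeries.subst_comp_subst_apply (.of_constantCoeff_zero' hφ)
      (PowerSeries.HasSubst.smul_X' lam)]

theorem pow_ne_self {lam : ℂ} (h0 : lam ≠ 0) (h1 : ‖lam‖ ≠ 1) {n : ℕ} (hn : 2 ≤ n) :
    lam ^ n ≠ lam := by
  intro h
  obtain ⟨m, rfl⟩ : ∃ m, n = m + 2 := ⟨n - 2, by omega⟩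
  rw [show m + 2 = (m + 1) + 1 by ring, pow_succ] at h
  have h2 := mul_right_cancel₀ h0 (h.trans (one_mul lam).symm)
  have h3 := congrArg norm h2
  rw [norm_pow, norm_one] at h3
  exact h1 ((pow_eq_one_iff_of_nonneg (norm_nonneg _) (by omega)).1 h3)

end HypCurve

theorem mainTheorem9 (F : (Fin 2 → ℂ) → (Fin 2 → ℂ)) (hF : HypCurve.IsDiffGerm F)
    (Γ : Ideal (MvPowerSeries (Fin 2) ℂ)) (hΓ : HypCurve.IsFormalCurve Γ)
    (hinv : HypCurve.IsInvariant F Γ) (hhyp : HypCurve.IsHyperbolic F Γ) :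
    HypCurve.IsAnalyticCurve Γ := by
  obtain ⟨lam, ⟨θ, ⟨hθ0, hθ1, γ, ⟨hγ, -⟩, hFγ⟩, rfl⟩, hlam⟩ := hhyp
  obtain ⟨φ, hφ0, hφ1, hφ⟩ := HypCurve.exists_formal_linearization hθ0 rfl
    fun n hn => HypCurve.pow_ne_self hθ1 hlam hn
  have hφ1' : PowerSeries.coeff 1 φ ≠ 0 := by rw [hφ1]; exact one_ne_zero
  have hγ' := hγ.comp hφ0 hφ1'
  have hFi : ∀ i, AnalyticAt ℂ (fun z => F z i) 0 := analyticAt_pi_iff.1 hF.analyticAt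
  choose M A hM hA hMA using fun i => HypCurve.exists_norm_coeff_taylorSeries_le (hFi i)
  refine HypCurve.isAnalyticCurve_of_convergent hΓ hγ'
    (HypCurve.isConvergentSeries_of_semiconj (φ := HypCurve.formalMap F) (M := M 0 + M 1)
      (A := A 0 + A 1) (add_nonneg (hM 0) (hM 1)) (add_pos (hA 0) (hA 1)).le ?_ ?_
      (fderiv ℂ F 0) hF.bijective_fderiv.1
      (HypCurve.fderiv_apply_eq_sum hF.analyticAt.differentiableAt)
      hγ'.constantCoeff_eq_zero hlam ?_)
  · have hMA' : ∀ i, M i ≤ M 0 + M 1 ∧ A i ≤ A 0 + A 1 := by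
      have := hM 0; have := hM 1; have := hA 0; have := hA 1
      intro i
      fin_cases i <;> constructor <;> simp <;> linarith
    intro i d
    refine (hMA i d).trans ?_
    have h1 := (hMA' i).1
    have h2 := (hMA' i).2
    have h3 := (hA i).le
    have h4 := (hM i).trans h1
    gcongr
  · intro i
    exact (HypCurve.coeff_zero_taylorSeries _).trans (congrFun hF.map_zero i)
  · intro i n
    have hs : PowerSeries.HasSubst θ := .of_constantCoeff_zero' hθ0
    -- F(γ(φ(s))) = γ(θ(φ(s))) = γ(φ(λs)), read off coefficientwise.
    rw [HypCurve.subst_subst_eq hγ.constantCoeff_eq_zero hφ0, hFγ i,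
      PowerSeries.subst_comp_subst_apply hs (.of_constantCoeff_zero' hφ0), hφ,
      HypCurve.subst_rescale_eq hφ0, PowerSeries.coeff_rescale]
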